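/- Let $1<\lambda<2$ and $$\Phi(\xi)=-\frac{2\sqrt{\pi}\,\Gamma\left(i\xi+1+\frac{\lambda}{2}\right)}{\Gamma\left(i\xi+\frac{\lambda+1}{2}\right)}.$$ Let $\frac{2+\lambda}{2}<\beta_1<\frac{3+\lambda}{2}$, where $\beta_1$ is not an odd multiple of $\frac{\lambda-1}{4}$ (so that the kernel below has no pole on the line of integration), and put $$\mathcal V(\xi)=\exp\left(\frac{2}{(\lambda-1)i}\int_{\operatorname{Im}\eta=\beta_1}\log(-\Phi(\eta))\left[\frac{1}{1-e^{\frac{4\pi}{\lambda-1}(\xi-\eta)}}-\frac{1}{1+e^{-\frac{4\pi}{\lambda-1}\eta}}\right]d\eta\right),\qquad \beta_1-\tfrac{\lambda-1}{2}<\operatorname{Im}\xi<\beta_1,$$ where $\log$ is the principal logarithm (on this line $\operatorname{Re}(-\Phi)>0$, so it is the continuous branch with $\arg(-\Phi(\eta))\to\pi/4$ as $\operatorname{Re}\eta\to+\infty$). Then $\mathcal V$ extends to a meromorphic function on $\mathbb C$, again denoted $\mathcal V$, whose zeros and poles are given by the following lists. Zeros: $$\left(1+\tfrac{\lambda}{2}+n+k\tfrac{\lambda-1}{2}\right)i\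 \ (n\ge1,\ k\ge0),\qquad \left(\tfrac{1+\lambda}{2}-k\tfrac{\lambda-1}{2}\right)i\ \ (k\ge1);$$ poles: $$\left(\tfrac{1+\lambda}{2}+n+k\tfrac{\lambda-1}{2}\right)i\ \ (n\ge1,\ k\ge0),\qquad \left(1+\tfrac{\lambda}{2}-k\tfrac{\lambda-1}{2}\right)i\ \ (k\ge1),$$ where $n,k$ are integers. The lists are understood with multiplicity, coinciding zeros and poles cancelling each other: for every $\xi\in\mathbb C$, the order of $\mathcal V$ at $\xi$ equals the number of occurrences of $\xi$ in the list of zeros minus the number of its occurrences in the list of poles. In particular, a point that does not belong to both lists is a zero of $\mathcal V$ if and only if it belongs to the first list, and a pole if and only if it belongs to the second. Hence, whenever $\lambda-1$ is not the quotient of two positive integers with odd numerator (for example, whenever $\lambda$ is irrational), the set of zeros of $\mathcal V$ is exactly the first list and the set of poles is exactly the second. -/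

import Mathlib

noncomputable section

namespace Coag

/-- The coefficient of the functional equation,
`Φ(ξ) = -2 √π Γ(iξ + 1 + λ/2) / Γ(iξ + (λ+1)/2)`. It is only evaluated at points where neither
Gamma function has a pole (the lines of integration below). -/
def Phi (lam : ℝ) (ξ : ℂ) : ℂ :=
  -(2 * (Real.sqrt Real.pi : ℂ) * Complex.Gamma (Complex.I * ξ + 1 + (lam : ℂ) / 2)) /
    Complex.Gamma (Complex.I * ξ + ((lam : ℂ) + 1) / 2)

/-- The kernel `1/(1 - e^{4π(ξ-η)/(λ-1)}) - 1/(1 + e^{-4πη/(λ-1)})`. -/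
def kernel (lam : ℝ) (ξ η : ℂ) : ℂ :=
  1 / (1 - Complex.exp (4 * (Real.pi : ℂ) / ((lam : ℂ) - 1) * (ξ - η))) -
    1 / (1 + Complex.exp (-(4 * (Real.pi : ℂ) / ((lam : ℂ) - 1) * η)))

/-- The function given by the explicit Cauchy-type integral along the line `Im η = β`,
`exp (2/((λ-1)i) ∫_{Im η = β} log(-Φ(η)) (1/(1-e^{4π(ξ-η)/(λ-1)}) - 1/(1+e^{-4πη/(λ-1)})) dη)`,
used for `β - (λ-1)/2 < Im ξ < β`. For `(2+λ)/2 < β < (3+λ)/2`, the only range used, `-Φ` has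
positive real part on the line, so the principal logarithm is the continuous branch along the line
whose imaginary part tends to `π/4` as `Re η → +∞`. -/
def Vpart (lam β : ℝ) (ξ : ℂ) : ℂ :=
  Complex.exp (2 / (((lam : ℂ) - 1) * Complex.I) *
    ∫ x : ℝ, Complex.log (-Phi lam ((x : ℂ) + (β : ℂ) * Complex.I)) *
      kernel lam ξ ((x : ℂ) + (β : ℂ) * Complex.I))

/-- `V` is a meromorphic function on `ℂ` which extends `Vpart lam β` from its strip of
definition. -/
def IsMeromorphicExtension (lam β : ℝ) (V : ℂ → ℂ) : Prop :=
  Meromorphic V ∧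
    ∀ ξ : ℂ, β - (lam - 1) / 2 < ξ.im → ξ.im < β → V ξ = Vpart lam β ξ

/-- The zeros of a meromorphic function: the points where its order is positive. -/
def zerosOf (V : ℂ → ℂ) : Set ℂ := {ξ | 0 < meromorphicOrderAt V ξ}

/-- The poles of a meromorphic function: the points where its order is negative. -/
def polesOf (V : ℂ → ℂ) : Set ℂ := {ξ | meromorphicOrderAt V ξ < 0}

/-- `(1 + λ/2 + n + k(λ-1)/2) i`. -/
def upperZero (lam : ℝ) (n k : ℕ) : ℂ :=
  ((1 + lam / 2 + n + k * ((lam - 1) / 2) : ℝ) : ℂ) * Complex.I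

/-- `((1+λ)/2 - k(λ-1)/2) i`. -/
def lowerZero (lam : ℝ) (k : ℕ) : ℂ :=
  (((1 + lam) / 2 - k * ((lam - 1) / 2) : ℝ) : ℂ) * Complex.I

/-- `((1+λ)/2 + n + k(λ-1)/2) i`. -/
def upperPole (lam : ℝ) (n k : ℕ) : ℂ :=
  (((1 + lam) / 2 + n + k * ((lam - 1) / 2) : ℝ) : ℂ) * Complex.I

/-- `(1 + λ/2 - k(λ-1)/2) i`. -/
def lowerPole (lam : ℝ) (k : ℕ) : ℂ :=
  ((1 + lam / 2 - k * ((lam - 1) / 2) : ℝ) : ℂ) * Complex.I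

/-- The list of zeros, as a set: both families, with `n ≥ 1`, `k ≥ 0` and with `k ≥ 1`. -/
def zeroSet (lam : ℝ) : Set ℂ :=
  {ξ | ∃ n k : ℕ, 1 ≤ n ∧ ξ = upperZero lam n k} ∪ {ξ | ∃ k : ℕ, 1 ≤ k ∧ ξ = lowerZero lam k}

/-- The list of poles, as a set. -/
def poleSet (lam : ℝ) : Set ℂ :=
  {ξ | ∃ n k : ℕ, 1 ≤ n ∧ ξ = upperPole lam n k} ∪ {ξ | ∃ k : ℕ, 1 ≤ k ∧ ξ = lowerPole lam k}

/-- The number of times that `ξ` occurs in the list of zeros (finite for `λ > 1`). -/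
def zeroCount (lam : ℝ) (ξ : ℂ) : ℕ :=
  {p : ℕ × ℕ | 1 ≤ p.1 ∧ ξ = upperZero lam p.1 p.2}.ncard +
    {k : ℕ | 1 ≤ k ∧ ξ = lowerZero lam k}.ncard

/-- The number of times that `ξ` occurs in the list of poles (finite for `λ > 1`). -/
def poleCount (lam : ℝ) (ξ : ℂ) : ℕ :=
  {p : ℕ × ℕ | 1 ≤ p.1 ∧ ξ = upperPole lam p.1 p.2}.ncard +
    {k : ℕ | 1 ≤ k ∧ ξ = lowerPole lam k}.ncard

end Coag

end

namespace Coag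

open Complex Filter Topology ComplexConjugate MeasureTheory

/-! Put `d = (λ-1)/2` and `a = 2π/d`. The kernel has period `di` in `ξ`, and in `η` it has a simple
pole at `η = ξ` with residue `1/a`. Raising the line of integration past `ξ` therefore changes the
integral by `di · log(-Φ(ξ))`, and the prefactor `2/((λ-1)i) = 1/(di)` turns this jump into the
functional equation `V(ξ - di) = -Φ(ξ) V(ξ)` (`lineInt_sub`, `exists_analytic_on_wide_strip`).

The contour shift needs a holomorphic logarithm of at most linear growth, against an exponentially
decaying kernel. Euler's limit for Gamma keeps `-Φ` off the negative axis in the strip `(2+λ)/2 < Im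
η < (3+λ)/2` (`Gamma_ratio_mem_slitPlane`); the reflection formula bounds `-Φ` and its inverse
exponentially (`exists_norm_log_neg_Phi_le`).

Being an exponential, the function has neither zeros nor poles on a strip slightly wider than `d`,
and the functional equation carries it to the plane (`exists_meromorphic_extension`). Each step down
by `di` adds the order of `-Φ`, which is read off from the poles of Gamma. The difference of the two
list counts obeys the same recursion (`meromorphicOrderAt_neg_Phi_eq`) and also vanishes on a strip
of height `d` (`listOrder_eq_zero`), so it is the order everywhere. -/

/-! ### The argument of `Γ(z + 1/2) / Γ(z)` -/

lemma add_mul_I_eq_polar (x y : ℝ) (hy : 0 < y) :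
    (x : ℂ) + y * I =
      (√(x ^ 2 + y ^ 2) : ℝ) * exp (((Real.pi / 2 - Real.arctan (x / y) : ℝ) : ℂ) * I) := by
  have hs : 0 < x ^ 2 + y ^ 2 := by positivity
  have h1 : √(1 + (x / y) ^ 2) = √(x ^ 2 + y ^ 2) / y := by
    rw [show 1 + (x / y) ^ 2 = (x ^ 2 + y ^ 2) / y ^ 2 by field_simp; ring,
      Real.sqrt_div hs.le, Real.sqrt_sq hy.le]
  have h2 := (Real.sqrt_pos.2 hs).ne'
  rw [exp_mul_I, ← ofReal_cos, ← ofReal_sin, Real.cos_pi_div_two_sub, Real.sin_pi_div_two_sub,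
    Real.sin_arctan, Real.cos_arctan, h1]
  rw [mul_add, ← mul_assoc, ← ofReal_mul, ← ofReal_mul,
    show √(x ^ 2 + y ^ 2) * (x / y / (√(x ^ 2 + y ^ 2) / y)) = x by field_simp,
    show √(x ^ 2 + y ^ 2) * (1 / (√(x ^ 2 + y ^ 2) / y)) = y by field_simp]

/-- The arguments of the factors add up to an angle in `[0, arg z]`. -/
lemma prod_div_add_half_polar {x y : ℝ} (hy : 0 < y) (n : ℕ) :
    ∃ r : ℝ, 0 ≤ r ∧ ∏ j ∈ Finset.range n, (((x : ℂ) + y * I + j) / ((x : ℂ) + y * I + 1 / 2 + j)) =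
      r * exp (((∑ j ∈ Finset.range n, (Real.arctan ((x + 1 / 2 + j) / y) -
        Real.arctan ((x + j) / y)) : ℝ) : ℂ) * I) := by
  induction n with
  | zero => exact ⟨1, by simp, by simp⟩
  | succ n ih =>
    obtain ⟨r, hr, h⟩ := ih
    refine ⟨r * (√((x + n) ^ 2 + y ^ 2) / √((x + 1 / 2 + n) ^ 2 + y ^ 2)), by positivity, ?_⟩
    rw [Finset.prod_range_succ, Finset.sum_range_succ, h]
    have e1 := add_mul_I_eq_polar (x + n) y hy
    have e2 := add_mul_I_eq_polar (x + 1 / 2 + n) y hy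
    rw [show (x : ℂ) + y * I + n = ((x + n : ℝ) : ℂ) + y * I by push_cast; ring,
      show (x : ℂ) + y * I + 1 / 2 + n = ((x + 1 / 2 + n : ℝ) : ℂ) + y * I by push_cast; ring,
      e1, e2, mul_div_mul_comm, ← exp_sub]
    have : ∀ S A B p : ℝ, exp (((S + (B - A) : ℝ) : ℂ) * I) =
        exp ((S : ℂ) * I) * exp (((p - A : ℝ) : ℂ) * I - ((p - B : ℝ) : ℂ) * I) := by
      intro S A B p
      rw [← exp_add]; congr 1; push_cast; ring
    rw [this _ _ _ (Real.pi / 2)]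
    push_cast
    ring

/-- Enlarging the half step to a full step makes the sum telescope; the upper bound is `arg (x +
iy)`. -/
lemma sum_arctan_bounds {x y : ℝ} (hy : 0 < y) (n : ℕ) :
    0 ≤ ∑ j ∈ Finset.range n, (Real.arctan ((x + 1 / 2 + j) / y) - Real.arctan ((x + j) / y)) ∧
    ∑ j ∈ Finset.range n, (Real.arctan ((x + 1 / 2 + j) / y) - Real.arctan ((x + j) / y)) ≤
      Real.pi / 2 - Real.arctan (x / y) := by
  constructor
  · refine Finset.sum_nonneg fun j _ => sub_nonneg.2 (Real.arctan_mono ?_)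
    gcongr
    linarith
  · have : ∑ j ∈ Finset.range n, (Real.arctan ((x + 1 / 2 + j) / y) - Real.arctan ((x + j) / y)) ≤
        ∑ j ∈ Finset.range n,
          (Real.arctan ((x + (j + 1 : ℕ)) / y) - Real.arctan ((x + j) / y)) := by
      refine Finset.sum_le_sum fun j _ => sub_le_sub_right (Real.arctan_mono ?_) _
      push_cast
      gcongr ?_ / _
      linarith
    refine this.trans ?_
    rw [Finset.sum_range_sub (fun j : ℕ => Real.arctan ((x + j) / y))]
    simp only [Nat.cast_zero, add_zero]
    linarith [Real.arctan_lt_pi_div_two ((x + n) / y)]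

lemma GammaSeq_ratio (z : ℂ) {n : ℕ} (hn : n ≠ 0) :
    GammaSeq (z + 1 / 2) n / GammaSeq z n =
      (√(n : ℝ) : ℝ) * ∏ j ∈ Finset.range (n + 1), ((z + j) / (z + 1 / 2 + j)) := by
  have hn' : (n : ℂ) ≠ 0 := by exact_mod_cast hn
  have hf : ((n.factorial : ℕ) : ℂ) ≠ 0 := by exact_mod_cast n.factorial_ne_zero
  have hz : (n : ℂ) ^ z ≠ 0 := by simp [cpow_eq_zero_iff, hn]
  have hs : (n : ℂ) ^ (1 / 2 : ℂ) = ((√(n : ℝ) : ℝ) : ℂ) := by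
    rw [Real.sqrt_eq_rpow, ofReal_cpow (by positivity)]
    simp
  rw [GammaSeq, GammaSeq, cpow_add _ _ hn', hs, Finset.prod_div_distrib]
  rw [div_div_div_eq, mul_div_assoc', show (n : ℂ) ^ z * ((√(n : ℝ) : ℝ) : ℂ) * n.factorial *
    ∏ j ∈ Finset.range (n + 1), (z + j) = ((n : ℂ) ^ z * n.factorial) *
    (((√(n : ℝ) : ℝ) : ℂ) * ∏ j ∈ Finset.range (n + 1), (z + j)) by ring,
    mul_comm (∏ j ∈ Finset.range (n + 1), (z + 1 / 2 + j)), mul_div_mul_left]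
  exact mul_ne_zero hz hf

lemma Gamma_ne_zero_of_re {z : ℂ} (h1 : -1 < z.re) (h2 : z.re < 0) : Gamma z ≠ 0 := by
  refine Gamma_ne_zero fun m hm => ?_
  have := congrArg re hm
  simp at this
  rcases m with _ | m
  · simp at this; linarith
  · push_cast at this
    have : (0 : ℝ) ≤ m := by positivity
    linarith

/-- In Euler's limit the ratio is a positive multiple of a product of factors `(z+j)/(z+1/2+j)`,
whose arguments add up to at most `arg z < π`. The limit stays in that closed sector and is nonzero.
-/
lemma Gamma_ratio_mem_slitPlane_of_im_pos {z : ℂ} (h1 : -1 < z.re) (h2 : z.re < -1 / 2)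
    (hz : 0 < z.im) : Gamma (z + 1 / 2) / Gamma z ∈ slitPlane := by
  set θ := Real.pi / 2 - Real.arctan (z.re / z.im) with hθ
  have hθ0 : 0 < θ := by have := Real.arctan_lt_pi_div_two (z.re / z.im); linarith
  have hθ1 : θ < Real.pi := by have := Real.neg_pi_div_two_lt_arctan (z.re / z.im); linarith
  have hG : Gamma z ≠ 0 := Gamma_ne_zero_of_re h1 (by linarith)
  have hG' : Gamma (z + 1 / 2) ≠ 0 :=
    Gamma_ne_zero_of_re (by simp; linarith) (by simp; linarith)
  have hlim := (GammaSeq_tendsto_Gamma (z + 1 / 2)).div (GammaSeq_tendsto_Gamma z) hG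
  -- The sector `0 ≤ arg w ≤ θ` with `θ = arg z`, as an intersection of two closed half-planes; it
  -- misses the negative axis because `0 < θ < π`.
  set S : Set ℂ := {w | 0 ≤ w.im} ∩ {w | (w * exp (((-θ : ℝ) : ℂ) * I)).im ≤ 0} with hS
  have hSc : IsClosed S := (isClosed_le continuous_const continuous_im).inter
    (isClosed_le (by fun_prop) continuous_const)
  have hmem : Gamma (z + 1 / 2) / Gamma z ∈ S := by
    refine hSc.mem_of_tendsto hlim ?_
    filter_upwards [eventually_ne_atTop 0] with n hn
    simp only [Pi.div_apply]
    rw [GammaSeq_ratio z hn]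
    obtain ⟨r, hr, h⟩ := prod_div_add_half_polar (x := z.re) hz (n + 1)
    obtain ⟨b1, b2⟩ := sum_arctan_bounds (x := z.re) hz (n + 1)
    rw [re_add_im] at h
    rw [h]
    set φ := ∑ j ∈ Finset.range (n + 1), (Real.arctan ((z.re + 1 / 2 + j) / z.im) -
        Real.arctan ((z.re + j) / z.im))
    have hr' : 0 ≤ √(n : ℝ) * r := by positivity
    constructor
    · show 0 ≤ ((((√(n : ℝ) : ℝ)) : ℂ) * (r * exp ((φ : ℂ) * I))).im
      rw [← mul_assoc, ← ofReal_mul, im_ofReal_mul, exp_ofReal_mul_I_im]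
      exact mul_nonneg hr' (Real.sin_nonneg_of_nonneg_of_le_pi b1 (by linarith))
    · show ((((√(n : ℝ) : ℝ)) : ℂ) * (r * exp ((φ : ℂ) * I)) *
        exp (((-θ : ℝ) : ℂ) * I)).im ≤ 0
      rw [← mul_assoc, mul_assoc, ← exp_add, ← add_mul, ← ofReal_add, ← ofReal_mul,
        im_ofReal_mul, exp_ofReal_mul_I_im]
      refine mul_nonpos_of_nonneg_of_nonpos hr' ?_
      exact Real.sin_nonpos_of_nonpos_of_neg_pi_le (by linarith) (by linarith)
  by_contra hc
  rw [mem_slitPlane_iff_not_le_zero, not_not, Complex.le_def] at hc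
  obtain ⟨c1, c2⟩ := hc
  simp only [zero_re, zero_im] at c1 c2
  set w := Gamma (z + 1 / 2) / Gamma z
  have hw : w ≠ 0 := div_ne_zero hG' hG
  have hwr : w.re < 0 := lt_of_le_of_ne c1 fun h => hw (Complex.ext h c2)
  have := hmem.2
  simp only [Set.mem_ofPred_eq, mul_im, c2, exp_ofReal_mul_I_im, Real.sin_neg, zero_mul, add_zero]
    at this
  have hs := Real.sin_pos_of_pos_of_lt_pi hθ0 hθ1
  nlinarith

lemma Gamma_ratio_mem_slitPlane {z : ℂ} (h1 : -1 < z.re) (h2 : z.re < -1 / 2) :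
    Gamma (z + 1 / 2) / Gamma z ∈ slitPlane := by
  rcases lt_trichotomy z.im 0 with h | h | h
  · have h3 := Gamma_ratio_mem_slitPlane_of_im_pos (z := conj z) (by simpa) (by simpa) (by simpa)
    have e : (conj z : ℂ) + 1 / 2 = conj (z + 1 / 2) := by
      rw [map_add, map_div₀, map_one, map_ofNat]
    rw [e, Gamma_conj, Gamma_conj, ← map_div₀] at h3
    rw [mem_slitPlane_iff] at h3 ⊢
    simpa only [conj_re, conj_im, neg_ne_zero] using h3
  · obtain ⟨x, rfl⟩ : ∃ x : ℝ, z = x := ⟨z.re, Complex.ext rfl h⟩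
    simp only [ofReal_re] at h1 h2
    have e : (x : ℂ) + 1 / 2 = ((x + 1 / 2 : ℝ) : ℂ) := by push_cast; ring
    rw [e, Gamma_ofReal, Gamma_ofReal, ← ofReal_div, mem_slitPlane_iff]
    left
    rw [ofReal_re]
    have k1 := Real.Gamma_add_one (s := x) (by linarith)
    have k2 := Real.Gamma_add_one (s := x + 1 / 2) (by linarith)
    have p1 := Real.Gamma_pos_of_pos (s := x + 1) (by linarith)
    have p2 := Real.Gamma_pos_of_pos (s := x + 1 / 2 + 1) (by linarith)
    exact div_pos_of_neg_of_neg (by nlinarith) (by nlinarith)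
  · exact Gamma_ratio_mem_slitPlane_of_im_pos h1 h2 h

/-! ### Exponential bounds for the Gamma quotient -/

lemma norm_Gamma_le_of_re_pos {z : ℂ} (hz : 0 < z.re) : ‖Gamma z‖ ≤ Real.Gamma z.re := by
  rw [Complex.Gamma_eq_integral hz, Real.Gamma_eq_integral hz, GammaIntegral]
  refine (norm_integral_le_integral_norm _).trans (le_of_eq ?_)
  refine setIntegral_congr_fun measurableSet_Ioi fun x hx => ?_
  simp only [norm_mul, norm_cpow_eq_rpow_re_of_pos hx, sub_re, one_re, norm_real,
    Real.norm_eq_abs, abs_of_pos (Real.exp_pos _)]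

lemma exists_norm_Gamma_le {p q : ℝ} (hp : 0 < p) :
    ∃ C : ℝ, 0 ≤ C ∧ ∀ z : ℂ, p ≤ z.re → z.re ≤ q → ‖Gamma z‖ ≤ C := by
  have hc : ContinuousOn Real.Gamma (Set.Icc p q) := fun x hx =>
    (Real.differentiableAt_Gamma fun m hm => by
      have : (0 : ℝ) ≤ m := by positivity
      linarith [hx.1]).continuousAt.continuousWithinAt
  obtain ⟨C, hC⟩ := isCompact_Icc.exists_bound_of_continuousOn hc
  refine ⟨max C 0, le_max_right _ _, fun z h1 h2 => ?_⟩
  refine (norm_Gamma_le_of_re_pos (hp.trans_le h1)).trans ?_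
  exact (le_abs_self _).trans ((hC z.re ⟨h1, h2⟩).trans (le_max_left _ _))

lemma norm_sin_le (z : ℂ) : ‖sin z‖ ≤ Real.exp |z.im| := by
  rw [sin, norm_div, norm_mul, norm_I, mul_one, show ‖(2 : ℂ)‖ = 2 by simp, div_le_iff₀ two_pos]
  refine (norm_sub_le _ _).trans ?_
  rw [norm_exp, norm_exp]
  have h1 : (-z * I).re ≤ |z.im| := by simpa using le_abs_self z.im
  have h2 : (z * I).re ≤ |z.im| := by simpa using neg_le_abs z.im
  linarith [Real.exp_le_exp.2 h1, Real.exp_le_exp.2 h2]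

lemma norm_inv_Gamma_le {z : ℂ} (hz : Gamma z ≠ 0) (hz' : Gamma (1 - z) ≠ 0) :
    ‖(Gamma z)⁻¹‖ ≤ ‖Gamma (1 - z)‖ * Real.exp (Real.pi * |z.im|) := by
  have h := Gamma_mul_Gamma_one_sub z
  have hs : sin (Real.pi * z) ≠ 0 := fun h0 => by
    rw [h0, div_zero] at h
    exact mul_ne_zero hz hz' h
  have hpi : (Real.pi : ℂ) ≠ 0 := by exact_mod_cast Real.pi_ne_zero
  have e : (Gamma z)⁻¹ = Gamma (1 - z) * sin (Real.pi * z) / Real.pi := by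
    rw [eq_div_iff hs] at h
    rw [eq_div_iff hpi, inv_mul_eq_iff_eq_mul₀ hz]
    linear_combination -h
  rw [e, norm_div, norm_mul, norm_real, Real.norm_eq_abs, abs_of_pos Real.pi_pos]
  have h2 := norm_sin_le (Real.pi * z)
  rw [im_ofReal_mul, abs_mul, abs_of_pos Real.pi_pos] at h2
  have h3 : (1 : ℝ) ≤ Real.pi := by linarith [Real.pi_gt_three]
  refine (div_le_self (by positivity) h3).trans ?_
  gcongr

/-- The numerator is moved into the right half-plane by `Γ(w) = Γ(w+1)/w`, where Gamma is bounded on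
vertical strips; the reciprocal of the denominator is bounded by reflection, at the cost of
`|sin(πz)| ≤ exp(π|Im z|)`. -/
lemma exists_norm_Gamma_ratio_le {p q : ℝ} (hp : -1 < p) (hq : q < -1 / 2) :
    ∃ C : ℝ, 0 ≤ C ∧ ∀ z : ℂ, p ≤ z.re → z.re ≤ q →
      ‖Gamma (z + 1 / 2) / Gamma z‖ ≤ C * Real.exp (Real.pi * |z.im|) ∧
      ‖Gamma z / Gamma (z + 1 / 2)‖ ≤ C * Real.exp (Real.pi * |z.im|) := by
  obtain ⟨C1, h1, H1⟩ := exists_norm_Gamma_le (p := p + 1) (q := q + 3 / 2) (by linarith)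
  obtain ⟨C2, h2, H2⟩ := exists_norm_Gamma_le (p := 1 / 2 - q) (q := 1 - p) (by linarith)
  set D := max (1 / (-q - 1 / 2)) (1 / (-q)) with hD
  have hD0 : 0 ≤ D := le_max_of_le_right (by apply div_nonneg <;> linarith)
  refine ⟨D * C1 * C2, by positivity, fun z hz1 hz2 => ?_⟩
  have key : ∀ w v : ℂ, -1 < w.re → w.re < 0 → -1 < v.re → v.re < 0 → |v.im| = |z.im| →
      1 / ‖w‖ ≤ D → ‖Gamma (w + 1)‖ ≤ C1 → ‖Gamma (1 - v)‖ ≤ C2 →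
      ‖Gamma w / Gamma v‖ ≤ D * C1 * C2 * Real.exp (Real.pi * |z.im|) := by
    intro w v w1 w2 v1 v2 hv hw b1 b2
    have w0 : w ≠ 0 := fun h => by simp [h] at w2
    have e : Gamma w = Gamma (w + 1) / w := by
      rw [Gamma_add_one _ w0]; field_simp
    have hv0 := Gamma_ne_zero_of_re v1 v2
    have hv1 : Gamma (1 - v) ≠ 0 := Gamma_ne_zero_of_re_pos (by simp; linarith)
    have := norm_inv_Gamma_le hv0 hv1
    rw [hv] at this
    rw [div_eq_mul_inv, norm_mul, e, norm_div, div_eq_mul_one_div]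
    calc ‖Gamma (w + 1)‖ * (1 / ‖w‖) * ‖(Gamma v)⁻¹‖
        ≤ C1 * D * (C2 * Real.exp (Real.pi * |z.im|)) := by
          gcongr
          exact this.trans (by gcongr)
      _ = _ := by ring
  have a1 : -q - 1 / 2 ≤ ‖z + 1 / 2‖ := by
    have := (neg_le_abs _).trans (abs_re_le_norm (z + 1 / 2))
    simp at this
    linarith
  have a2 : -q ≤ ‖z‖ := by
    have := (neg_le_abs _).trans (abs_re_le_norm z)
    linarith
  constructor
  · apply key
    · simp; linarith
    · simp; linarith
    · linarith
    · linarith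
    · rfl
    · exact le_max_of_le_left (one_div_le_one_div_of_le (by linarith) a1)
    · apply H1 <;> simp <;> linarith
    · apply H2 <;> simp <;> linarith
  · apply key
    · linarith
    · linarith
    · simp; linarith
    · simp; linarith
    · simp
    · exact le_max_of_le_right (one_div_le_one_div_of_le (by linarith) a2)
    · apply H1 <;> simp <;> linarith
    · apply H2 <;> simp <;> linarith

/-! ### The logarithm of `-Φ` on the strip -/

lemma neg_Phi_eq (lam : ℝ) (η : ℂ) :
    -Phi lam η = ((2 * √Real.pi : ℝ) : ℂ) * (Gamma ((I * η + ((lam : ℂ) + 1) / 2) + 1 / 2) /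
      Gamma (I * η + ((lam : ℂ) + 1) / 2)) := by
  rw [Phi, show I * η + 1 + (lam : ℂ) / 2 = (I * η + ((lam : ℂ) + 1) / 2) + 1 / 2 by ring]
  push_cast
  ring

lemma Phi_arg_re (lam : ℝ) (η : ℂ) :
    (I * η + ((lam : ℂ) + 1) / 2).re = (lam + 1) / 2 - η.im := by
  simp [add_re, mul_re]
  ring

lemma Phi_arg_im (lam : ℝ) (η : ℂ) : (I * η + ((lam : ℂ) + 1) / 2).im = η.re := by
  simp [add_im, mul_im]

lemma neg_Phi_mem_slitPlane {lam : ℝ} {η : ℂ} (h1 : (2 + lam) / 2 < η.im)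
    (h2 : η.im < (3 + lam) / 2) : -Phi lam η ∈ slitPlane := by
  have h := Gamma_ratio_mem_slitPlane (z := I * η + ((lam : ℂ) + 1) / 2)
    (by rw [Phi_arg_re]; linarith) (by rw [Phi_arg_re]; linarith)
  have hc : 0 < 2 * √Real.pi := by positivity
  rw [neg_Phi_eq]
  rw [mem_slitPlane_iff] at h ⊢
  rw [re_ofReal_mul, im_ofReal_mul]
  rcases h with h | h
  · exact Or.inl (mul_pos hc h)
  · exact Or.inr (mul_ne_zero hc.ne' h)

lemma differentiableAt_Phi {lam : ℝ} {η : ℂ} (h1 : (2 + lam) / 2 < η.im)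
    (h2 : η.im < (3 + lam) / 2) : DifferentiableAt ℂ (fun η => -Phi lam η) η := by
  have hz : -1 < (I * η + ((lam : ℂ) + 1) / 2).re := by rw [Phi_arg_re]; linarith
  have hz' : (I * η + ((lam : ℂ) + 1) / 2).re < -1 / 2 := by rw [Phi_arg_re]; linarith
  have key : ∀ w : ℂ, -1 < w.re → w.re < 0 → DifferentiableAt ℂ Gamma w := by
    intro w w1 w2
    refine differentiableAt_Gamma w fun m hm => Gamma_ne_zero_of_re w1 w2 ?_
    rw [hm, Gamma_neg_nat_eq_zero]
  simp only [neg_Phi_eq]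
  refine DifferentiableAt.const_mul (DifferentiableAt.div ?_ ?_ ?_) _
  · exact DifferentiableAt.comp (g := Gamma)
      (f := fun η : ℂ => I * η + ((lam : ℂ) + 1) / 2 + 1 / 2) η
      (key _ (by simp only [add_re] at *; norm_num; linarith)
      (by simp only [add_re] at *; norm_num; linarith)) (by fun_prop)
  · exact DifferentiableAt.comp (g := Gamma) (f := fun η : ℂ => I * η + ((lam : ℂ) + 1) / 2) η
      (key _ hz (by linarith)) (by fun_prop)
  · exact Gamma_ne_zero_of_re hz (by linarith)

lemma differentiableAt_log_neg_Phi {lam : ℝ} {η : ℂ} (h1 : (2 + lam) / 2 < η.im)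
    (h2 : η.im < (3 + lam) / 2) : DifferentiableAt ℂ (fun η => log (-Phi lam η)) η :=
  (differentiableAt_Phi h1 h2).clog (neg_Phi_mem_slitPlane h1 h2)

/-- Exponential bounds on both `-Φ` and its inverse bound the real part of the logarithm linearly
from both sides; the imaginary part is at most `π`. -/
lemma exists_norm_log_neg_Phi_le {lam b₀ b₁ : ℝ} (h0 : (2 + lam) / 2 < b₀)
    (h1 : b₁ < (3 + lam) / 2) :
    ∃ A : ℝ, 0 ≤ A ∧ ∀ η : ℂ, b₀ ≤ η.im → η.im ≤ b₁ →
      ‖log (-Phi lam η)‖ ≤ A * (1 + |η.re|) := by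
  obtain ⟨C, hC, H⟩ := exists_norm_Gamma_ratio_le (p := (lam + 1) / 2 - b₁)
    (q := (lam + 1) / 2 - b₀) (by linarith) (by linarith)
  set c := 2 * √Real.pi with hc
  have hc0 : 0 < c := by positivity
  set M := max (c * C) (c⁻¹ * C) with hM
  set B := max 0 (Real.log M) with hB
  refine ⟨B + Real.pi + Real.pi, by positivity, fun η e1 e2 => ?_⟩
  obtain ⟨H1, H2⟩ := H (I * η + ((lam : ℂ) + 1) / 2) (by rw [Phi_arg_re]; linarith)
    (by rw [Phi_arg_re]; linarith)
  rw [Phi_arg_im] at H1 H2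
  have hne : -Phi lam η ≠ 0 :=
    slitPlane_ne_zero (neg_Phi_mem_slitPlane (h0.trans_le e1) (e2.trans_lt h1))
  have hpos : 0 < ‖-Phi lam η‖ := norm_pos_iff.2 hne
  have G1 : ‖-Phi lam η‖ ≤ M * Real.exp (Real.pi * |η.re|) := by
    rw [neg_Phi_eq, norm_mul, norm_real, Real.norm_eq_abs, abs_of_pos hc0]
    calc _ ≤ c * (C * Real.exp (Real.pi * |η.re|)) := by gcongr
      _ = c * C * Real.exp (Real.pi * |η.re|) := by ring
      _ ≤ _ := by gcongr; exact le_max_left _ _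
  have G2 : ‖-Phi lam η‖⁻¹ ≤ M * Real.exp (Real.pi * |η.re|) := by
    rw [neg_Phi_eq, norm_mul, norm_real, Real.norm_eq_abs, abs_of_pos hc0, mul_inv,
      ← norm_inv, inv_div]
    calc _ ≤ c⁻¹ * (C * Real.exp (Real.pi * |η.re|)) := by gcongr
      _ = c⁻¹ * C * Real.exp (Real.pi * |η.re|) := by ring
      _ ≤ _ := by gcongr; exact le_max_right _ _
  have hM0 : 0 < M := by
    by_contra hm
    have : M * Real.exp (Real.pi * |η.re|) ≤ 0 :=
      mul_nonpos_of_nonpos_of_nonneg (not_lt.1 hm) (Real.exp_pos _).le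
    linarith
  have L1 := Real.log_le_log hpos G1
  have L2 := Real.log_le_log (inv_pos.2 hpos) G2
  rw [Real.log_mul hM0.ne' (Real.exp_pos _).ne', Real.log_exp] at L1 L2
  rw [Real.log_inv] at L2
  have hBl : Real.log M ≤ B := le_max_right _ _
  have hB0 : 0 ≤ B := le_max_left _ _
  have habs : |Real.log ‖-Phi lam η‖| ≤ B + Real.pi * |η.re| := abs_le.2 ⟨by linarith, by linarith⟩
  have hn := norm_le_abs_re_add_abs_im (log (-Phi lam η))
  rw [log_re, log_im] at hn
  have ha := abs_arg_le_pi (-Phi lam η)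
  have := Real.pi_pos
  have hx := abs_nonneg η.re
  nlinarith [mul_nonneg hB0 hx, mul_nonneg this.le hx]

/-! ### Integrability and shifting of horizontal lines -/

lemma integrable_comp_abs_of_integrableOn_Ioi {f : ℝ → ℝ}
    (hf : IntegrableOn f (Set.Ioi 0)) : Integrable fun x : ℝ => f |x| := by
  have h1 : IntegrableOn (fun x : ℝ => f |x|) (Set.Ioi 0) :=
    hf.congr_fun (fun x hx => by rw [abs_of_pos hx]) measurableSet_Ioi
  have h2 : IntegrableOn (fun x : ℝ => f |x|) (Set.Iic 0) := by
    rw [integrableOn_Iic_iff_integrableOn_Iio]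
    have := (Measure.measurePreserving_neg (volume : Measure ℝ)).integrableOn_comp_preimage
      (Homeomorph.neg ℝ).measurableEmbedding (f := fun x : ℝ => f |x|) (s := Set.Ioi 0)
    have h3 := this.2 h1
    have e : (Neg.neg : ℝ → ℝ) ⁻¹' Set.Ioi 0 = Set.Iio 0 := by ext x; simp
    rw [e] at h3
    exact h3.congr_fun (fun x _ => by simp) measurableSet_Iio
  rw [← integrableOn_univ, ← Set.Iic_union_Ioi (a := (0 : ℝ))]
  exact h2.union h1

lemma integrable_one_add_abs_mul_exp {a : ℝ} (ha : 0 < a) :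
    Integrable fun x : ℝ => (1 + |x|) * Real.exp (-(a * |x|)) := by
  refine integrable_comp_abs_of_integrableOn_Ioi (f := fun x => (1 + x) * Real.exp (-(a * x))) ?_
  have h : IntegrableOn (fun x : ℝ => (1 + 2 / a) * Real.exp (-(a / 2) * x)) (Set.Ioi 0) :=
    (integrableOn_exp_mul_Ioi (by linarith) 0).const_mul _
  refine h.mono' (by fun_prop) ?_
  filter_upwards [ae_restrict_mem measurableSet_Ioi] with x hx
  have hx : 0 < x := hx
  rw [Real.norm_eq_abs, abs_of_pos (by positivity)]
  have e : Real.exp (-(a * x)) = Real.exp (-(a / 2) * x) * Real.exp (-(a / 2) * x) := by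
    rw [← Real.exp_add]; ring_nf
  -- Half of the exponent absorbs the linear factor, since `(a/2)x ≤ exp((a/2)x)`.
  have h1 : (1 + x) * Real.exp (-(a / 2) * x) ≤ 1 + 2 / a := by
    have h2 := Real.add_one_le_exp (a / 2 * x)
    have h3 : Real.exp (-(a / 2) * x) ≤ 1 := Real.exp_le_one_iff.2 (by nlinarith)
    have h4 : Real.exp (a / 2 * x) * Real.exp (-(a / 2) * x) = 1 := by
      rw [← Real.exp_add]; simp
    have h5 := Real.exp_pos (-(a / 2) * x)
    have h6 : x = 2 / a * (a / 2 * x) := by field_simp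
    have h7 : (a / 2 * x) * Real.exp (-(a / 2) * x) ≤ 1 := by nlinarith
    calc (1 + x) * Real.exp (-(a / 2) * x)
        = Real.exp (-(a / 2) * x) + 2 / a * ((a / 2 * x) * Real.exp (-(a / 2) * x)) := by
          nth_rewrite 1 [h6]; ring
      _ ≤ 1 + 2 / a * 1 := by gcongr
      _ = _ := by ring
  rw [e, ← mul_assoc]
  gcongr

lemma tendsto_one_add_mul_exp {a : ℝ} (ha : 0 < a) :
    Tendsto (fun x : ℝ => (1 + x) * Real.exp (-(a * x))) atTop (𝓝 0) := by
  have h1 := Real.tendsto_pow_mul_exp_neg_atTop_nhds_zero 0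
  have h2 := Real.tendsto_pow_mul_exp_neg_atTop_nhds_zero 1
  have ht : Tendsto (fun x : ℝ => a * x) atTop atTop := tendsto_id.const_mul_atTop ha
  have h := (h1.comp ht).add ((h2.comp ht).const_mul a⁻¹)
  simp only [mul_zero, add_zero] at h
  refine h.congr fun x => ?_
  simp only [Function.comp, pow_zero, pow_one]
  field_simp

/-- Shifting a horizontal line of integration through a strip of holomorphy. -/
lemma integral_line_eq_of_strip {f : ℂ → ℂ} {b₀ b₁ R : ℝ} {g : ℝ → ℝ} (hb : b₀ ≤ b₁)
    (hf : DifferentiableOn ℂ f {z | b₀ ≤ z.im ∧ z.im ≤ b₁})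
    (htail : ∀ z : ℂ, b₀ ≤ z.im → z.im ≤ b₁ → R ≤ |z.re| → ‖f z‖ ≤ g |z.re|)
    (hg : Tendsto g atTop (𝓝 0))
    (h0 : Integrable fun x : ℝ => f (x + b₀ * I)) (h1 : Integrable fun x : ℝ => f (x + b₁ * I)) :
    ∫ x : ℝ, f (x + b₀ * I) = ∫ x : ℝ, f (x + b₁ * I) := by
  have t0 := intervalIntegral_tendsto_integral h0 tendsto_neg_atTop_atBot tendsto_id
  have t1 := intervalIntegral_tendsto_integral h1 tendsto_neg_atTop_atBot tendsto_id
  have key : Tendsto (fun T : ℝ => (∫ x in (-T)..T, f (x + b₀ * I)) -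
      ∫ x in (-T)..T, f (x + b₁ * I)) atTop (𝓝 0) := by
    have hz : Tendsto (fun T : ℝ => 2 * (g T * |b₁ - b₀|)) atTop (𝓝 0) := by
      simpa using (hg.mul_const |b₁ - b₀|).const_mul 2
    refine squeeze_zero_norm' ?_ hz
    filter_upwards [eventually_ge_atTop R, eventually_ge_atTop 0] with T hT hT0
    have hrect := integral_boundary_rect_eq_zero_of_differentiableOn f
      ((-T : ℝ) + b₀ * I) ((T : ℝ) + b₁ * I) (hf.mono fun z hz => by
        rw [mem_reProdIm] at hz
        have := hz.2
        simp only [add_im, ofReal_im, mul_im, ofReal_re, I_im, mul_one, I_re, mul_zero, add_zero,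
          zero_add] at this
        rw [Set.uIcc_of_le hb] at this
        exact this)
    simp only [add_im, ofReal_im, mul_im, ofReal_re, I_im, mul_one, I_re, mul_zero, add_zero,
          zero_add, add_re, mul_re, sub_zero] at hrect
    have side : ∀ s : ℝ, |s| = T → ‖I • ∫ y in b₀..b₁, f (s + y * I)‖ ≤ g T * |b₁ - b₀| := by
      intro s hs
      rw [norm_smul, norm_I, one_mul]
      refine intervalIntegral.norm_integral_le_of_norm_le_const fun y hy => ?_
      rw [Set.uIoc_of_le hb] at hy
      have := htail (s + y * I) (by simpa using hy.1.le) (by simpa using hy.2)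
        (by simpa [hs] using hT)
      simpa [hs] using this
    have e : (∫ x in (-T)..T, f (x + b₀ * I)) - ∫ x in (-T)..T, f (x + b₁ * I) =
        (I • ∫ y in b₀..b₁, f ((-T : ℝ) + y * I)) - I • ∫ y in b₀..b₁, f ((T : ℝ) + y * I) := by
      linear_combination hrect
    rw [e]
    refine (norm_sub_le _ _).trans ?_
    linarith [side (-T) (by rw [abs_neg, abs_of_nonneg hT0]), side T (abs_of_nonneg hT0)]
  have := tendsto_nhds_unique key (t0.sub t1)
  exact (sub_eq_zero.1 this.symm)

/-! ### Estimates for the kernel -/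

/-- With `r = |e^w|` and `s = sin(Im w / 2)`, one has `|1 - e^w|² = (1-r)² + 4rs²`, which exceeds
`s²(1+r)²` by `(1-s²)(1-r)²`. -/
lemma one_add_exp_mul_abs_sin_le (w : ℂ) :
    |Real.sin (w.im / 2)| * (1 + Real.exp w.re) ≤ ‖1 - exp w‖ := by
  have hr := Real.exp_pos w.re
  set r := Real.exp w.re
  set s := Real.sin (w.im / 2)
  have hc : Real.cos w.im = 1 - 2 * s ^ 2 := by
    have := Real.cos_sq_add_sin_sq (w.im / 2)
    have h2 := Real.cos_two_mul (w.im / 2)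
    rw [show 2 * (w.im / 2) = w.im by ring] at h2
    nlinarith
  have h : ‖1 - exp w‖ ^ 2 = (1 - r) ^ 2 + 4 * r * s ^ 2 := by
    rw [← normSq_eq_norm_sq, normSq_apply]
    have h3 := Real.cos_sq_add_sin_sq w.im
    simp only [sub_re, one_re, sub_im, one_im, exp_re, exp_im]
    rw [hc] at h3 ⊢
    linear_combination r ^ 2 * h3
  have hs1 : s ^ 2 ≤ 1 := Real.sin_sq_le_one _
  refine abs_le_of_sq_le_sq' ?_ (norm_nonneg _) |>.2
  rw [h, mul_pow, sq_abs]
  nlinarith [mul_nonneg (sub_nonneg.2 hs1) (sq_nonneg (1 - r))]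

lemma abs_one_sub_exp_re_le (w : ℂ) : |1 - Real.exp w.re| ≤ ‖1 - exp w‖ := by
  have := abs_norm_sub_norm_le (1 : ℂ) (exp w)
  rwa [norm_one, norm_exp] at this

/-- The constant is `tanh(a/2)`, the minimum of `|tanh(at/2)|` over `|t| ≥ 1`. -/
lemma mul_one_add_exp_le_of_one_le_abs {a t : ℝ} (ha : 0 < a) (ht : 1 ≤ |t|) :
    (1 - Real.exp (-a)) / (1 + Real.exp (-a)) * (1 + Real.exp (a * t)) ≤
      |1 - Real.exp (a * t)| := by
  have hp := Real.exp_pos (-a)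
  rw [div_mul_eq_mul_div, div_le_iff₀ (by positivity)]
  rcases le_abs.1 ht with h | h
  · have h1 : 1 ≤ Real.exp (a * t) * Real.exp (-a) := by
      rw [← Real.exp_add]
      exact Real.one_le_exp (by nlinarith)
    nlinarith [neg_le_abs (1 - Real.exp (a * t))]
  · have h1 : Real.exp (a * t) ≤ Real.exp (-a) := Real.exp_le_exp.2 (by nlinarith)
    nlinarith [le_abs_self (1 - Real.exp (a * t))]

/-- The kernel with a general frequency `a`. -/
noncomputable def ker (a : ℝ) (ξ η : ℂ) : ℂ :=
  1 / (1 - exp (a * (ξ - η))) - 1 / (1 + exp (-(a * η)))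

lemma ker_bound_aux {p q t : ℝ} (hp : 0 < p) (hq : 0 < q) (ht : 0 < t) (h : q = t ∨ q * t = 1) :
    q * (1 + p) / ((1 + p * q) * (1 + q)) ≤ (1 + p) * (1 + 1 / p) * t := by
  rw [div_le_iff₀ (by positivity)]
  rcases h with rfl | h
  · have : q * (1 + p) * 1 ≤ q * (1 + p) * ((1 + 1 / p) * ((1 + p * q) * (1 + q))) := by
      refine mul_le_mul_of_nonneg_left ?_ (by positivity)
      have h1 : 0 ≤ 1 / p := by positivity
      have h2 : 1 ≤ (1 + p * q) * (1 + q) := by nlinarith [mul_pos hp hq]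
      nlinarith
    calc _ = q * (1 + p) * 1 := by ring
      _ ≤ _ := this
      _ = _ := by ring
  · have ht' : t = 1 / q := by field_simp; linarith
    rw [ht']
    have : (1 + p) * (1 + 1 / p) * (1 / q) * ((1 + p * q) * (1 + q)) =
      q * (1 + p) + (1 + p) * (1 / q + 2 + p + p * q + 1 / (p * q) + 1 / p) := by
      field_simp; ring
    rw [this]
    have : 0 ≤ (1 + p) * (1 / q + 2 + p + p * q + 1 / (p * q) + 1 / p) := by positivity
    linarith

lemma exp_neg_mul_eq_or (a x : ℝ) : Real.exp (-(a * x)) = Real.exp (-(a * |x|)) ∨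
    Real.exp (-(a * x)) * Real.exp (-(a * |x|)) = 1 := by
  rcases abs_choice x with h | h
  · left; rw [h]
  · right; rw [h, ← Real.exp_add]; simp

/-- Over a common denominator the numerator is `e^{-aη}(1 + e^{aξ})`: the second term of the kernel
cancels the limit `1` of the first as `Re η → +∞`, so the difference decays at both ends. -/
lemma norm_ker_le {a κ κ' : ℝ} (hκ : 0 < κ) (hκ' : 0 < κ') {ξ η : ℂ}
    (h : κ * (1 + Real.exp (a * (ξ.re - η.re))) ≤ ‖1 - exp (a * (ξ - η))‖)
    (h' : κ' * (1 + Real.exp (-(a * η.re))) ≤ ‖1 + exp (-(a * η))‖) :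
    ‖ker a ξ η‖ ≤ (1 + Real.exp (a * ξ.re)) * (1 + 1 / Real.exp (a * ξ.re)) / (κ * κ') *
      Real.exp (-(a * |η.re|)) := by
  have n1 : 1 - exp (a * (ξ - η)) ≠ 0 := norm_pos_iff.1 (lt_of_lt_of_le (by positivity) h)
  have n2 : 1 + exp (-(a * η)) ≠ 0 := norm_pos_iff.1 (lt_of_lt_of_le (by positivity) h')
  have e : ker a ξ η = exp (-(a * η)) * (1 + exp (a * ξ)) /
      ((1 - exp (a * (ξ - η))) * (1 + exp (-(a * η)))) := by
    have e1 : exp (a * (ξ - η)) = exp (a * ξ) * exp (-(a * η)) := by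
      rw [← exp_add]; ring_nf
    rw [e1] at n1 ⊢
    rw [ker, e1]
    field_simp
    ring
  have r1 : (-(a * η)).re = -(a * η.re) := by simp
  have r2 : (a * ξ : ℂ).re = a * ξ.re := by simp
  rw [e, norm_div, norm_mul, norm_mul, norm_exp, r1]
  have hn : ‖1 + exp (a * ξ)‖ ≤ 1 + Real.exp (a * ξ.re) := by
    refine (norm_add_le _ _).trans ?_
    rw [norm_one, norm_exp, r2]
  have e3 : Real.exp (a * (ξ.re - η.re)) = Real.exp (a * ξ.re) * Real.exp (-(a * η.re)) := by
    rw [← Real.exp_add]; ring_nf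
  rw [e3] at h
  have main := ker_bound_aux (Real.exp_pos (a * ξ.re)) (Real.exp_pos (-(a * η.re)))
    (Real.exp_pos (-(a * |η.re|))) (exp_neg_mul_eq_or a η.re)
  set p := Real.exp (a * ξ.re)
  set q := Real.exp (-(a * η.re))
  have hp : 0 < p := Real.exp_pos _
  have hq : 0 < q := Real.exp_pos _
  calc _ ≤ q * (1 + p) / ((κ * (1 + p * q)) * (κ' * (1 + q))) := by gcongr
    _ = q * (1 + p) / ((1 + p * q) * (1 + q)) / (κ * κ') := by
      field_simp
    _ ≤ (1 + p) * (1 + 1 / p) * Real.exp (-(a * |η.re|)) / (κ * κ') := by gcongr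
    _ = _ := by ring

lemma sin_mul_one_add_exp_le (a : ℝ) (ξ η : ℂ) :
    |Real.sin (a * (ξ.im - η.im) / 2)| * (1 + Real.exp (a * (ξ.re - η.re))) ≤
      ‖1 - exp (a * (ξ - η))‖ := by
  have := one_add_exp_mul_abs_sin_le (a * (ξ - η))
  simpa using this

lemma cos_mul_one_add_exp_le (a : ℝ) (η : ℂ) :
    |Real.cos (a * η.im / 2)| * (1 + Real.exp (-(a * η.re))) ≤ ‖1 + exp (-(a * η))‖ := by
  have h := one_add_exp_mul_abs_sin_le (-(a * η) + Real.pi * I)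
  rw [exp_add, exp_pi_mul_I, mul_neg_one, sub_neg_eq_add] at h
  have e : Real.sin ((-(a * η) + Real.pi * I : ℂ).im / 2) = Real.cos (a * η.im / 2) := by
    rw [← Real.sin_pi_div_two_sub]
    congr 1
    simp
    ring
  rw [e] at h
  simpa using h

/-- The derivative of the kernel in its first variable. -/
noncomputable def kerDeriv (a : ℝ) (ξ η : ℂ) : ℂ := a * exp (a * (ξ - η)) / (1 - exp (a * (ξ - η))) ^ 2

lemma hasDerivAt_ker {a : ℝ} {ξ η : ℂ} (h : 1 - exp (a * (ξ - η)) ≠ 0) :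
    HasDerivAt (fun ξ => ker a ξ η) (kerDeriv a ξ η) ξ := by
  have h1 : HasDerivAt (fun ξ : ℂ => (a : ℂ) * (ξ - η)) a ξ := by
    simpa using ((hasDerivAt_id ξ).sub_const η).const_mul (a : ℂ)
  have h2 := ((h1.cexp.const_sub 1).inv h).sub_const (1 / (1 + exp (-(a * η))))
  simp only [ker, one_div, kerDeriv]
  simp only [one_div] at h2
  convert! h2 using 1
  ring

lemma norm_kerDeriv_le {a κ R : ℝ} (ha : 0 < a) (hκ : 0 < κ) {ξ η : ℂ} (hR : |ξ.re| ≤ R)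
    (h : κ * (1 + Real.exp (a * (ξ.re - η.re))) ≤ ‖1 - exp (a * (ξ - η))‖) :
    ‖kerDeriv a ξ η‖ ≤ a * Real.exp (a * R) / κ ^ 2 * Real.exp (-(a * |η.re|)) := by
  have e1 : (a * (ξ - η) : ℂ).re = a * (ξ.re - η.re) := by simp
  rw [kerDeriv, norm_div, norm_mul, norm_exp, norm_pow, norm_real, Real.norm_eq_abs,
    abs_of_pos ha, e1]
  set t := ξ.re - η.re
  have hr := Real.exp_pos (a * t)
  have h1 : Real.exp (a * t) / (1 + Real.exp (a * t)) ^ 2 ≤ Real.exp (-(a * |t|)) := by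
    rw [div_le_iff₀ (by positivity)]
    rcases abs_choice t with h | h
    · rw [h]
      have : Real.exp (a * t) = Real.exp (-(a * t)) * Real.exp (a * t) ^ 2 := by
        rw [← Real.exp_nat_mul, ← Real.exp_add]; push_cast; ring_nf
      rw [this]
      have hp := Real.exp_pos (-(a * t))
      gcongr
      rw [← this]
      linarith
    · rw [h, mul_neg, neg_neg]
      nlinarith [pow_pos hr 2]
  have h2 : Real.exp (-(a * |t|)) ≤ Real.exp (a * R) * Real.exp (-(a * |η.re|)) := by
    rw [← Real.exp_add]
    refine Real.exp_le_exp.2 ?_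
    have : |η.re| ≤ |ξ.re| + |t| := by
      have := abs_sub ξ.re t
      rwa [sub_sub_cancel] at this
    nlinarith
  calc _ ≤ a * Real.exp (a * t) / (κ * (1 + Real.exp (a * t))) ^ 2 := by gcongr
    _ = a / κ ^ 2 * (Real.exp (a * t) / (1 + Real.exp (a * t)) ^ 2) := by
      field_simp
    _ ≤ a / κ ^ 2 * (Real.exp (a * R) * Real.exp (-(a * |η.re|))) := by
      gcongr
      exact h1.trans h2
    _ = _ := by ring

/-! ### Cauchy-type integrals along horizontal lines -/

/-- The hypotheses on the density `L` of a Cauchy-type integral with kernel `ker a` along the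
horizontal lines of the strip `b₀ ≤ Im η ≤ b₁`. -/
structure Admissible (a b₀ b₁ A : ℝ) (L : ℂ → ℂ) : Prop where
  a_pos : 0 < a
  lt : b₀ < b₁
  -- Less than one period, so that the closed strip contains no translate of an interior point `ξ`
  -- and the kernel has no pole there but `η = ξ`.
  width : b₁ - b₀ < 2 * Real.pi / a
  A_nonneg : 0 ≤ A
  diff : ∀ η : ℂ, b₀ ≤ η.im → η.im ≤ b₁ → DifferentiableAt ℂ L η
  bound : ∀ η : ℂ, b₀ ≤ η.im → η.im ≤ b₁ → ‖L η‖ ≤ A * (1 + |η.re|)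
  cos_ne : ∀ y, b₀ ≤ y → y ≤ b₁ → Real.cos (a * y / 2) ≠ 0

/-- The Cauchy-type integral with density `L` along the line `Im η = b`. -/
noncomputable def lineInt (a : ℝ) (L : ℂ → ℂ) (b : ℝ) (ξ : ℂ) : ℂ :=
  ∫ x : ℝ, L (x + b * I) * ker a ξ (x + b * I)

variable {a b₀ b₁ A : ℝ} {L : ℂ → ℂ}

lemma sin_ne_zero_of_abs_lt {a s : ℝ} (ha : 0 < a) (hs : s ≠ 0) (h : |s| < 2 * Real.pi / a) :
    Real.sin (a * s / 2) ≠ 0 := by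
  rw [lt_div_iff₀ ha] at h
  have h1 : |a * s / 2| < Real.pi := by
    rw [abs_div, abs_mul, abs_of_pos ha, abs_two]; linarith
  have h2 := abs_lt.1 h1
  rw [Ne, Real.sin_eq_zero_iff_of_lt_of_lt h2.1 h2.2]
  have := mul_ne_zero ha.ne' hs
  simpa using this

lemma one_sub_exp_ne_zero {a : ℝ} {ξ η : ℂ} (h : Real.sin (a * (ξ.im - η.im) / 2) ≠ 0) :
    1 - exp (a * (ξ - η)) ≠ 0 := by
  refine norm_pos_iff.1 (lt_of_lt_of_le ?_ (sin_mul_one_add_exp_le a ξ η))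
  have := abs_pos.2 h
  positivity

lemma one_add_exp_ne_zero {a : ℝ} {η : ℂ} (h : Real.cos (a * η.im / 2) ≠ 0) :
    1 + exp (-(a * η)) ≠ 0 := by
  refine norm_pos_iff.1 (lt_of_lt_of_le ?_ (cos_mul_one_add_exp_le a η))
  have := abs_pos.2 h
  positivity

lemma differentiableAt_ker {a : ℝ} {ξ η : ℂ} (h1 : 1 - exp (a * (ξ - η)) ≠ 0)
    (h2 : 1 + exp (-(a * η)) ≠ 0) : DifferentiableAt ℂ (ker a ξ) η := by
  unfold ker
  fun_prop (disch := assumption)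

namespace Admissible

lemma one (h : Admissible a b₀ b₁ A L) : Admissible a b₀ b₁ 1 (fun _ => 1) where
  a_pos := h.a_pos
  lt := h.lt
  width := h.width
  A_nonneg := zero_le_one
  diff := by simp
  bound := by simp
  cos_ne := h.cos_ne

lemma continuous_line (h : Admissible a b₀ b₁ A L) {b : ℝ} (hb : b₀ ≤ b) (hb' : b ≤ b₁) :
    Continuous fun x : ℝ => L (x + b * I) :=
  continuous_iff_continuousAt.2 fun x => ContinuousAt.comp (g := L)
    (h.diff _ (by simpa) (by simpa)).continuousAt (by fun_prop)

lemma continuous_ker_line (h : Admissible a b₀ b₁ A L) {b : ℝ} (hb : b₀ ≤ b) (hb' : b ≤ b₁)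
    {ξ : ℂ} (hs : Real.sin (a * (ξ.im - b) / 2) ≠ 0) :
    Continuous fun x : ℝ => ker a ξ (x + b * I) :=
  continuous_iff_continuousAt.2 fun x => ContinuousAt.comp (g := ker a ξ)
    (differentiableAt_ker (one_sub_exp_ne_zero (by simpa using hs))
      (one_add_exp_ne_zero (by simpa using h.cos_ne b hb hb'))).continuousAt (by fun_prop)

lemma integrable (h : Admissible a b₀ b₁ A L) {b : ℝ} (hb : b₀ ≤ b) (hb' : b ≤ b₁)
    {ξ : ℂ} (hs : Real.sin (a * (ξ.im - b) / 2) ≠ 0) :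
    Integrable fun x : ℝ => L (x + b * I) * ker a ξ (x + b * I) := by
  have hc := (h.continuous_line hb hb').mul (h.continuous_ker_line hb hb' hs)
  have hk := fun x : ℝ => norm_ker_le (a := a) (ξ := ξ) (η := x + b * I) (abs_pos.2 hs)
    (abs_pos.2 (h.cos_ne b hb hb')) (by simpa using sin_mul_one_add_exp_le a ξ (x + b * I))
    (by simpa using cos_mul_one_add_exp_le a (x + b * I))
  set C := (1 + Real.exp (a * ξ.re)) * (1 + 1 / Real.exp (a * ξ.re)) /
    (|Real.sin (a * (ξ.im - b) / 2)| * |Real.cos (a * b / 2)|)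
  refine ((integrable_one_add_abs_mul_exp h.a_pos).const_mul (A * C)).mono'
    hc.aestronglyMeasurable (.of_forall fun x => ?_)
  have h1 := h.bound (x + b * I) (by simpa) (by simpa)
  have h2 := hk x
  simp only [add_re, ofReal_re, mul_re, I_re, mul_zero, ofReal_im, I_im, mul_one, sub_self,
    add_zero] at h1 h2
  rw [norm_mul]
  calc _ ≤ A * (1 + |x|) * (C * Real.exp (-(a * |x|))) := by
        have := h.A_nonneg
        gcongr
    _ = _ := by ring

lemma exists_cos_lower_bound (h : Admissible a b₀ b₁ A L) :
    ∃ κ : ℝ, 0 < κ ∧ ∀ y, b₀ ≤ y → y ≤ b₁ → κ ≤ |Real.cos (a * y / 2)| := by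
  obtain ⟨y, hy, hmin⟩ := isCompact_Icc.exists_isMinOn (Set.nonempty_Icc.2 h.lt.le)
    (f := fun y => |Real.cos (a * y / 2)|) (by fun_prop)
  exact ⟨_, abs_pos.2 (h.cos_ne y hy.1 hy.2), fun z h1 h2 => hmin ⟨h1, h2⟩⟩

/-- The sine bound degenerates at the height of `ξ`. At horizontal distance at least `1` the modulus
of the exponential alone keeps the denominator away from zero, uniformly in the height. -/
lemma exists_ker_tail_bound (h : Admissible a b₀ b₁ A L) (ξ : ℂ) :
    ∃ C : ℝ, 0 ≤ C ∧ ∀ η : ℂ, b₀ ≤ η.im → η.im ≤ b₁ → |ξ.re| + 1 ≤ |η.re| →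
      ‖ker a ξ η‖ ≤ C * Real.exp (-(a * |η.re|)) := by
  obtain ⟨κ', hκ', H⟩ := h.exists_cos_lower_bound
  have ha := h.a_pos
  have hκ : 0 < (1 - Real.exp (-a)) / (1 + Real.exp (-a)) :=
    div_pos (sub_pos.2 (Real.exp_lt_one_iff.2 (by linarith))) (by positivity)
  refine ⟨(1 + Real.exp (a * ξ.re)) * (1 + 1 / Real.exp (a * ξ.re)) /
    ((1 - Real.exp (-a)) / (1 + Real.exp (-a)) * κ'), by positivity, fun η h1 h2 h3 => ?_⟩
  refine norm_ker_le hκ hκ' ?_ ?_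
  · have h4 : 1 ≤ |ξ.re - η.re| := by
      have := abs_sub_abs_le_abs_sub η.re ξ.re
      rw [abs_sub_comm] at this
      linarith
    refine (mul_one_add_exp_le_of_one_le_abs ha h4).trans ?_
    simpa using abs_one_sub_exp_re_le (a * (ξ - η))
  · refine le_trans ?_ (cos_mul_one_add_exp_le a η)
    gcongr
    exact H _ h1 h2

/-- On a closed ball around `ξ` inside the open strip one period high below the line, the sine has a
positive minimum, which yields a dominating function uniform over the ball. -/
lemma hasDerivAt_lineInt (h : Admissible a b₀ b₁ A L) {b : ℝ} (hb : b₀ ≤ b) (hb' : b ≤ b₁)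
    {ξ : ℂ} (h1 : b - 2 * Real.pi / a < ξ.im) (h2 : ξ.im < b) :
    Integrable (fun x : ℝ => L (x + b * I) * kerDeriv a ξ (x + b * I)) ∧
    HasDerivAt (lineInt a L b) (∫ x : ℝ, L (x + b * I) * kerDeriv a ξ (x + b * I)) ξ := by
  have ha := h.a_pos
  set U : Set ℂ := {z | b - 2 * Real.pi / a < z.im ∧ z.im < b} with hU
  have hsin : ∀ z ∈ U, Real.sin (a * (z.im - b) / 2) ≠ 0 := fun z hz =>
    sin_ne_zero_of_abs_lt ha (by linarith [hz.2])
      (abs_lt.2 ⟨by linarith [hz.1], by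
        have : 0 < 2 * Real.pi / a := by positivity
        linarith [hz.2]⟩)
  have hUo : IsOpen U := (isOpen_lt continuous_const continuous_im).inter
    (isOpen_lt continuous_im continuous_const)
  obtain ⟨ε, hε, hball⟩ := Metric.nhds_basis_closedBall.mem_iff.1 (hUo.mem_nhds ⟨h1, h2⟩)
  obtain ⟨w, hw, hmin⟩ := (isCompact_closedBall ξ ε).exists_isMinOn
    (Metric.nonempty_closedBall.2 hε.le)
    (f := fun z : ℂ => |Real.sin (a * (z.im - b) / 2)|) (by fun_prop)
  set κ := |Real.sin (a * (w.im - b) / 2)|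
  have hκ : 0 < κ := abs_pos.2 (hsin w (hball hw))
  set R := ‖ξ‖ + ε
  have hs := hsin ξ ⟨h1, h2⟩
  have hne : ∀ z ∈ Metric.closedBall ξ ε, ∀ x : ℝ, 1 - exp (a * (z - (x + b * I))) ≠ 0 :=
    fun z hz x => one_sub_exp_ne_zero (by simpa using hsin z (hball hz))
  refine hasDerivAt_integral_of_dominated_loc_of_deriv_le (μ := volume)
    (F := fun ξ x => L (x + b * I) * ker a ξ (x + b * I))
    (F' := fun ξ x => L (x + b * I) * kerDeriv a ξ (x + b * I))
    (bound := fun x => A * (a * Real.exp (a * R) / κ ^ 2) *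
      ((1 + |x|) * Real.exp (-(a * |x|))))
    (Metric.closedBall_mem_nhds ξ hε) ?_ (h.integrable hb hb' hs) ?_ ?_
    ((integrable_one_add_abs_mul_exp ha).const_mul _) ?_
  · filter_upwards [hUo.mem_nhds (show ξ ∈ U from ⟨h1, h2⟩)] with z hz
    exact ((h.continuous_line hb hb').mul
      (h.continuous_ker_line hb hb' (hsin z hz))).aestronglyMeasurable
  · refine ((h.continuous_line hb hb').mul ?_).aestronglyMeasurable
    unfold kerDeriv
    refine Continuous.div (by fun_prop) (by fun_prop) fun x => pow_ne_zero 2 ?_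
    exact hne ξ (Metric.mem_closedBall_self hε.le) x
  · refine .of_forall fun x z hz => ?_
    have hre : |z.re| ≤ R := by
      refine (abs_re_le_norm z).trans ?_
      have := norm_le_norm_add_norm_sub' z ξ
      rw [Metric.mem_closedBall, dist_eq_norm] at hz
      linarith
    have h3 := norm_kerDeriv_le (η := x + b * I) ha hκ hre (by
      refine le_trans ?_ (sin_mul_one_add_exp_le a z (x + b * I))
      gcongr
      simpa using hmin hz)
    have h4 := h.bound (x + b * I) (by simpa) (by simpa)
    simp only [add_re, ofReal_re, mul_re, I_re, mul_zero, ofReal_im, I_im, mul_one, sub_self,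
      add_zero] at h3 h4
    rw [norm_mul]
    have := h.A_nonneg
    calc _ ≤ A * (1 + |x|) * (a * Real.exp (a * R) / κ ^ 2 * Real.exp (-(a * |x|))) := by
          gcongr
      _ = _ := by ring
  · exact .of_forall fun x z hz => (hasDerivAt_ker (hne z hz x)).const_mul _

/-- The integrals along both boundary lines agree below the strip. -/
lemma lineInt_eq (h : Admissible a b₀ b₁ A L) {ξ : ℂ} (h1 : b₁ - 2 * Real.pi / a < ξ.im)
    (h2 : ξ.im < b₀) : lineInt a L b₀ ξ = lineInt a L b₁ ξ := by
  have ha := h.a_pos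
  have hlt := h.lt
  have hA := h.A_nonneg
  have hsin : ∀ y, b₀ ≤ y → y ≤ b₁ → Real.sin (a * (ξ.im - y) / 2) ≠ 0 := fun y y0 y1 =>
    sin_ne_zero_of_abs_lt ha (by linarith) (abs_lt.2 ⟨by linarith, by
        have : 0 < 2 * Real.pi / a := by positivity
        linarith⟩)
  obtain ⟨C, hC, H⟩ := h.exists_ker_tail_bound ξ
  refine integral_line_eq_of_strip (f := fun η => L η * ker a ξ η) (R := |ξ.re| + 1)
    (g := fun x => A * C * ((1 + x) * Real.exp (-(a * x)))) h.lt.le ?_ ?_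
    (by simpa using (tendsto_one_add_mul_exp ha).const_mul (A * C))
    (h.integrable le_rfl hlt.le (hsin _ le_rfl hlt.le))
    (h.integrable hlt.le le_rfl (hsin _ hlt.le le_rfl))
  · exact fun η hη => ((h.diff η hη.1 hη.2).mul (differentiableAt_ker
      (one_sub_exp_ne_zero (hsin _ hη.1 hη.2))
      (one_add_exp_ne_zero (h.cos_ne _ hη.1 hη.2)))).differentiableWithinAt
  · intro η e1 e2 e3
    rw [norm_mul]
    calc _ ≤ A * (1 + |η.re|) * (C * Real.exp (-(a * |η.re|))) := by
          gcongr
          · exact h.bound η e1 e2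
          · exact H η e1 e2 e3
      _ = _ := by ring

end Admissible

/-! ### Periodicity and the jump across a line -/

lemma exp_mul_sub_period {a : ℝ} (ha : 0 < a) (ξ η : ℂ) :
    exp (a * (ξ - (2 * Real.pi / a : ℝ) * I - η)) = exp (a * (ξ - η)) := by
  have ha' : (a : ℂ) ≠ 0 := by exact_mod_cast ha.ne'
  have e : (a : ℂ) * (ξ - (2 * Real.pi / a : ℝ) * I - η) = a * (ξ - η) - 2 * Real.pi * I := by
    push_cast
    field_simp
    ring
  rw [e, exp_sub, exp_two_pi_mul_I, div_one]

lemma ker_sub_period {a : ℝ} (ha : 0 < a) (ξ η : ℂ) :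
    ker a (ξ - (2 * Real.pi / a : ℝ) * I) η = ker a ξ η := by
  rw [ker, ker, exp_mul_sub_period ha]

lemma lineInt_sub_period {a : ℝ} (ha : 0 < a) (L : ℂ → ℂ) (b : ℝ) (ξ : ℂ) :
    lineInt a L b (ξ - (2 * Real.pi / a : ℝ) * I) = lineInt a L b ξ := by
  simp only [lineInt, ker_sub_period ha]

/-- Along the line, `-(1 - e^{a(ξ-η)})⁻¹` is a primitive, with limits `0` and `-1` at the two ends.
-/
lemma integral_kerDeriv_line {b : ℝ} (ha : 0 < a) {ξ : ℂ}
    (hne : ∀ x : ℝ, 1 - exp (a * (ξ - (x + b * I))) ≠ 0)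
    (hint : Integrable fun x : ℝ => kerDeriv a ξ (x + b * I)) :
    ∫ x : ℝ, kerDeriv a ξ (x + b * I) = -1 := by
  have hd : ∀ x : ℝ, HasDerivAt (fun x : ℝ => -(1 - exp (a * (ξ - (x + b * I))))⁻¹)
      (kerDeriv a ξ (x + b * I)) x := by
    intro x
    have h1 : HasDerivAt (fun x : ℝ => (a : ℂ) * (ξ - (x + b * I))) (a * -1) x := by
      have := (((hasDerivAt_id x).ofReal_comp.add_const (b * I : ℂ)).const_sub ξ).const_mul (a : ℂ)
      simpa using this
    have h2 := ((h1.cexp.const_sub 1).inv (hne x)).neg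
    convert! h2 using 1
    rw [kerDeriv]
    ring
  have hnorm : ∀ x : ℝ, ‖exp (a * (ξ - (x + b * I)))‖ = Real.exp (a * (ξ.re - x)) := by
    intro x
    rw [norm_exp]
    congr 1
    simp
  have htop : Tendsto (fun x : ℝ => -(1 - exp (a * (ξ - (x + b * I))))⁻¹) atTop (𝓝 (-1)) := by
    have h0 : Tendsto (fun x : ℝ => exp (a * (ξ - (x + b * I)))) atTop (𝓝 0) := by
      rw [tendsto_zero_iff_norm_tendsto_zero]
      simp only [hnorm]
      refine Real.tendsto_exp_atBot.comp (Tendsto.const_mul_atBot ha ?_)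
      exact tendsto_atBot_add_const_left _ _ tendsto_neg_atTop_atBot
    simpa using ((h0.const_sub 1).inv₀ (by simp)).neg
  have hbot : Tendsto (fun x : ℝ => -(1 - exp (a * (ξ - (x + b * I))))⁻¹) atBot (𝓝 0) := by
    have h0 : Tendsto (fun x : ℝ => 1 - exp (a * (ξ - (x + b * I)))) atBot
        (Bornology.cobounded ℂ) := by
      rw [← tendsto_norm_atTop_iff_cobounded]
      refine tendsto_atTop_mono (f := fun x : ℝ => Real.exp (a * (ξ.re - x)) - 1) (fun x => ?_) ?_
      · have := norm_sub_norm_le (exp (a * (ξ - (x + b * I)))) 1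
        rwa [hnorm, norm_one, norm_sub_rev] at this
      · refine tendsto_atTop_add_const_right _ _ (Real.tendsto_exp_atTop.comp ?_)
        refine Tendsto.const_mul_atTop ha ?_
        exact tendsto_atTop_add_const_left _ _ tendsto_neg_atBot_atTop
    simpa using (tendsto_inv₀_cobounded.comp h0).neg
  rw [integral_of_hasDerivAt_of_tendsto hd hint hbot htop, sub_zero]

namespace Admissible

lemma hasDerivAt_lineInt_one (h : Admissible a b₀ b₁ A L) {b : ℝ} (hb : b₀ ≤ b) (hb' : b ≤ b₁)
    {ξ : ℂ} (h1 : b - 2 * Real.pi / a < ξ.im) (h2 : ξ.im < b) :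
    HasDerivAt (lineInt a (fun _ => 1) b) (-1) ξ := by
  obtain ⟨hi, hd⟩ := h.one.hasDerivAt_lineInt hb hb' h1 h2
  simp only [one_mul] at hi hd
  rwa [integral_kerDeriv_line h.a_pos (fun x => one_sub_exp_ne_zero ?_) hi] at hd
  refine sin_ne_zero_of_abs_lt h.a_pos (by simp; linarith) ?_
  have : 0 < 2 * Real.pi / a := div_pos (by positivity) h.a_pos
  simp only [add_im, ofReal_im, mul_im, ofReal_re, I_im, mul_one, I_re, mul_zero, add_zero,
          zero_add]
  exact abs_lt.2 ⟨by linarith, by linarith⟩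

lemma exists_lineInt_one_eq (h : Admissible a b₀ b₁ A L) {b : ℝ} (hb : b₀ ≤ b) (hb' : b ≤ b₁) :
    ∃ c : ℂ, ∀ ξ : ℂ, b - 2 * Real.pi / a < ξ.im → ξ.im < b →
      lineInt a (fun _ => 1) b ξ = c - ξ := by
  set U : Set ℂ := {z | b - 2 * Real.pi / a < z.im} ∩ {z | z.im < b} with hU
  have hUo : IsOpen U := (isOpen_lt continuous_const continuous_im).inter
    (isOpen_lt continuous_im continuous_const)
  have hUc : IsPreconnected U :=
    ((convex_halfSpace_im_gt _).inter (convex_halfSpace_im_lt _)).isPreconnected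
  have hd : ∀ z ∈ U, HasDerivAt (fun z => lineInt a (fun _ => 1) b z + z) 0 z := by
    intro z hz
    simpa using (h.hasDerivAt_lineInt_one hb hb' hz.1 hz.2).fun_add (hasDerivAt_id' z)
  obtain ⟨c, hc⟩ := hUo.exists_is_const_of_deriv_eq_zero hUc
    (fun z hz => (hd z hz).differentiableAt.differentiableWithinAt)
    (fun z hz => (hd z hz).deriv)
  exact ⟨c, fun ξ h1 h2 => eq_sub_of_add_eq (hc ξ ⟨h1, h2⟩)⟩

/-- The residue computation for constant density. Below each line the integral is `c - ξ`, with the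
same `c` for both lines because they agree on the overlap of their strips; a point between the lines
must first be lowered by one period to lie below `b₀`, which adds `di` with `d = 2π/a`. -/
lemma lineInt_one_sub (h : Admissible a b₀ b₁ A L) {ξ : ℂ} (h1 : b₀ < ξ.im) (h2 : ξ.im < b₁) :
    lineInt a (fun _ => 1) b₀ ξ - lineInt a (fun _ => 1) b₁ ξ = (2 * Real.pi / a : ℝ) * I := by
  have hw := h.width
  obtain ⟨c₀, e₀⟩ := h.exists_lineInt_one_eq le_rfl h.lt.le
  obtain ⟨c₁, e₁⟩ := h.exists_lineInt_one_eq h.lt.le le_rfl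
  have hd : 0 < 2 * Real.pi / a := div_pos (by positivity) h.a_pos
  set d := 2 * Real.pi / a
  have hc : c₀ = c₁ := by
    have i : ((((b₁ - d + b₀) / 2 : ℝ) : ℂ) * I).im = (b₁ - d + b₀) / 2 := by simp
    have := h.one.lineInt_eq (ξ := ((b₁ - d + b₀) / 2 : ℝ) * I) (by rw [i]; linarith)
      (by rw [i]; linarith)
    rw [e₀ _ (by rw [i]; linarith [h.lt]) (by rw [i]; linarith),
      e₁ _ (by rw [i]; linarith) (by rw [i]; linarith [h.lt])] at this
    exact sub_left_injective this
  have i2 : (ξ - d * I).im = ξ.im - d := by simp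
  rw [← lineInt_sub_period h.a_pos, e₀ _ (by rw [i2]; linarith) (by rw [i2]; linarith),
    e₁ _ (by linarith) h2, hc]
  ring

lemma eq_of_one_sub_exp_eq_zero (h : Admissible a b₀ b₁ A L) {ξ η : ℂ} (h1 : b₀ < ξ.im)
    (h2 : ξ.im < b₁) (e1 : b₀ ≤ η.im) (e2 : η.im ≤ b₁) (h0 : 1 - exp (a * (ξ - η)) = 0) :
    η = ξ := by
  have hw := h.width
  have him : η.im = ξ.im := by
    by_contra hne
    refine one_sub_exp_ne_zero (sin_ne_zero_of_abs_lt h.a_pos (sub_ne_zero.2 (Ne.symm hne)) ?_) h0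
    exact abs_lt.2 ⟨by linarith, by linarith⟩
  refine Complex.ext ?_ him
  have h3 := abs_one_sub_exp_re_le (a * (ξ - η))
  rw [h0, norm_zero] at h3
  have h4 : Real.exp (a * (ξ.re - η.re)) = 1 := by
    have := abs_eq_zero.1 (le_antisymm h3 (abs_nonneg _))
    simp at this
    linarith
  rw [Real.exp_eq_one_iff, mul_eq_zero] at h4
  rcases h4 with h4 | h4
  · exact absurd h4 h.a_pos.ne'
  · linarith

/-- Crossing the pole `η = ξ` of the kernel. -/
lemma lineInt_sub (h : Admissible a b₀ b₁ A L) {ξ : ℂ} (h1 : b₀ < ξ.im) (h2 : ξ.im < b₁) :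
    lineInt a L b₀ ξ - lineInt a L b₁ ξ = (2 * Real.pi / a : ℝ) * I * L ξ := by
  have ha := h.a_pos
  have hw := h.width
  have hA := h.A_nonneg
  have hd : 0 < 2 * Real.pi / a := div_pos (by positivity) h.a_pos
  have s0 : Real.sin (a * (ξ.im - b₀) / 2) ≠ 0 :=
    sin_ne_zero_of_abs_lt ha (by linarith) (abs_lt.2 ⟨by linarith, by linarith⟩)
  have s1 : Real.sin (a * (ξ.im - b₁) / 2) ≠ 0 :=
    sin_ne_zero_of_abs_lt ha (by linarith) (abs_lt.2 ⟨by linarith, by linarith⟩)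
  set S : Set ℂ := {z | b₀ ≤ z.im ∧ z.im ≤ b₁} with hS
  have hSn : S ∈ 𝓝 ξ := by
    filter_upwards [(isOpen_lt continuous_const continuous_im).mem_nhds h1,
      (isOpen_lt continuous_im continuous_const).mem_nhds h2] with z z1 z2
    exact ⟨le_of_lt z1, le_of_lt z2⟩
  set E : ℂ → ℂ := fun η => 1 - exp (a * (ξ - η)) with hE
  have hEd : HasDerivAt E a ξ := by
    have h3 : HasDerivAt (fun η : ℂ => (a : ℂ) * (ξ - η)) (a * -1) ξ := by
      simpa using ((hasDerivAt_id ξ).const_sub ξ).const_mul (a : ℂ)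
    simpa using h3.cexp.const_sub 1
  have hEξ : E ξ = 0 := by simp [hE]
  have hE0 : ∀ η ∈ S, η ≠ ξ → E η ≠ 0 := fun η hη hne h0 =>
    hne (h.eq_of_one_sub_exp_eq_zero h1 h2 hη.1 hη.2 h0)
  have hEs : ∀ η ∈ S, dslope E ξ η ≠ 0 := by
    intro η hη
    rcases eq_or_ne η ξ with rfl | hne
    · rw [dslope_same, hEd.deriv]
      exact_mod_cast ha.ne'
    · rw [dslope_of_ne _ hne, slope_def_field, hEξ, sub_zero]
      exact div_ne_zero (hE0 η hη hne) (sub_ne_zero.2 hne)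
  -- This is `(L η - L ξ) · ker a ξ η` with the singularity at `ξ` removed: both factors `η - ξ` are
  -- divided out, and the divided denominator has no zero in the strip. The remaining term `L ξ ·
  -- ker` is the constant-density case.
  set f : ℂ → ℂ := fun η => dslope L ξ η / dslope E ξ η - (L η - L ξ) / (1 + exp (-(a * η)))
    with hf
  have hfeq : ∀ η ∈ S, η ≠ ξ → f η = L η * ker a ξ η - L ξ * ker a ξ η := by
    intro η hη hne
    have h3 : E η ≠ 0 := hE0 η hη hne
    have h4 := sub_ne_zero.2 hne
    simp only [hf]
    rw [dslope_of_ne _ hne, dslope_of_ne _ hne, slope_def_field, slope_def_field, hEξ, sub_zero,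
      div_div_div_cancel_right₀ h4, ker]
    ring
  have hfd : DifferentiableOn ℂ f S := by
    have hL : DifferentiableOn ℂ L S := fun η hη =>
      (h.diff η hη.1 hη.2).differentiableWithinAt
    have hEdiff : DifferentiableOn ℂ E S := by fun_prop
    refine DifferentiableOn.sub (DifferentiableOn.div
      ((Complex.differentiableOn_dslope hSn).2 hL) ((Complex.differentiableOn_dslope hSn).2 hEdiff)
      hEs) ?_
    refine DifferentiableOn.div (hL.sub_const _) (by fun_prop) fun η hη => ?_
    exact one_add_exp_ne_zero (h.cos_ne _ hη.1 hη.2)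
  have line : ∀ b, b₀ ≤ b → b ≤ b₁ → Real.sin (a * (ξ.im - b) / 2) ≠ 0 → b ≠ ξ.im →
      Integrable (fun x : ℝ => f (x + b * I)) ∧
      ∫ x : ℝ, f (x + b * I) = lineInt a L b ξ - L ξ * lineInt a (fun _ => 1) b ξ := by
    intro b hb hb' hs hbne
    have i1 := h.integrable hb hb' hs
    have i2 := (h.one.integrable hb hb' hs).const_mul (L ξ)
    simp only [one_mul] at i2
    have e : (fun x : ℝ => f (x + b * I)) = fun x : ℝ => L (x + b * I) * ker a ξ (x + b * I) -
        L ξ * ker a ξ (x + b * I) := by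
      funext x
      refine hfeq _ (by simp [hS, hb, hb']) fun hx => hbne ?_
      rw [← hx]; simp
    rw [e]
    refine ⟨i1.sub i2, ?_⟩
    rw [integral_sub i1 i2, integral_const_mul]
    simp only [lineInt, one_mul]
  obtain ⟨C, hC, H⟩ := h.exists_ker_tail_bound ξ
  obtain ⟨j0, k0⟩ := line b₀ le_rfl h.lt.le s0 h1.ne
  obtain ⟨j1, k1⟩ := line b₁ h.lt.le le_rfl s1 h2.ne'
  have hshift := integral_line_eq_of_strip (f := f) (R := |ξ.re| + 1)
    (g := fun x => (A + ‖L ξ‖) * C * ((1 + x) * Real.exp (-(a * x)))) h.lt.le hfd (by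
      intro η e1 e2 e3
      rw [hfeq η ⟨e1, e2⟩ (fun he => by rw [he] at e3; linarith), ← sub_mul, norm_mul]
      have hb := h.bound η e1 e2
      have hle : ‖L η - L ξ‖ ≤ (A + ‖L ξ‖) * (1 + |η.re|) := by
        refine (norm_sub_le _ _).trans ?_
        nlinarith [norm_nonneg (L ξ), abs_nonneg η.re,
          mul_nonneg (norm_nonneg (L ξ)) (abs_nonneg η.re)]
      calc _ ≤ (A + ‖L ξ‖) * (1 + |η.re|) * (C * Real.exp (-(a * |η.re|))) := by
            gcongr
            exact H η e1 e2 e3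
        _ = _ := by ring)
    (by simpa using (tendsto_one_add_mul_exp ha).const_mul ((A + ‖L ξ‖) * C)) j0 j1
  rw [k0, k1] at hshift
  have hone := h.lineInt_one_sub h1 h2
  linear_combination hshift + L ξ * hone

end Admissible

/-! ### The exponential of the integral on a strip wider than a period -/

lemma kernel_eq_ker (lam : ℝ) (ξ η : ℂ) : kernel lam ξ η = ker (4 * Real.pi / (lam - 1)) ξ η := by
  rw [kernel, ker]
  push_cast
  rfl

lemma exists_admissible {lam β : ℝ} (hlam : 1 < lam) (hβ : (2 + lam) / 2 < β)
    (hβ' : β < (3 + lam) / 2) (hne : ∀ m : ℤ, β ≠ (2 * (m : ℝ) + 1) * ((lam - 1) / 4)) :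
    ∃ β₁ A : ℝ, β₁ < β + (lam - 1) / 2 ∧ β₁ < (3 + lam) / 2 ∧
      Admissible (4 * Real.pi / (lam - 1)) β β₁ A (fun η => log (-Phi lam η)) := by
  have hl : 0 < lam - 1 := by linarith
  set a := 4 * Real.pi / (lam - 1) with ha
  have ha0 : 0 < a := by positivity
  have had : 2 * Real.pi / a = (lam - 1) / 2 := by rw [ha]; field_simp; ring
  have hcos : Real.cos (a * β / 2) ≠ 0 := by
    rw [Ne, Real.cos_eq_zero_iff]
    rintro ⟨k, hk⟩
    refine hne k ?_
    rw [ha] at hk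
    field_simp at hk
    linarith
  have hev : ∀ᶠ y in 𝓝 β, Real.cos (a * y / 2) ≠ 0 :=
    (by fun_prop : ContinuousAt (fun y => Real.cos (a * y / 2)) β).eventually_ne hcos
  obtain ⟨ε, hε, hball⟩ := Metric.eventually_nhds_iff.1 hev
  -- The three bounds keep, in turn, the cosine nonzero, the width below the period `(λ-1)/2`, and
  -- the upper line below `(3+λ)/2`.
  set δ := min (ε / 2) (min ((lam - 1) / 4) (((3 + lam) / 2 - β) / 2)) with hδ
  have d0 : 0 < δ := lt_min (by linarith) (lt_min (by linarith) (by linarith))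
  have d1 : δ ≤ ε / 2 := min_le_left _ _
  have d2 : δ ≤ (lam - 1) / 4 := (min_le_right _ _).trans (min_le_left _ _)
  have d3 : δ ≤ ((3 + lam) / 2 - β) / 2 := (min_le_right _ _).trans (min_le_right _ _)
  have hb1 : β + δ < (3 + lam) / 2 := by linarith
  obtain ⟨A, hA, H⟩ := exists_norm_log_neg_Phi_le (lam := lam) hβ hb1
  refine ⟨β + δ, A, by linarith, hb1, ⟨ha0, by linarith, by rw [had]; linarith, hA, ?_, H, ?_⟩⟩
  · exact fun η e1 e2 => differentiableAt_log_neg_Phi (by linarith) (by linarith)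
  · intro y y1 y2
    refine hball ?_
    rw [Real.dist_eq, abs_of_nonneg (by linarith)]
    linarith

/-- Integrating along the higher line `β₁` continues the function past `β`. For `β < Im ξ < β₁`,
periodicity identifies the value at `ξ - di` with the integral along `β` evaluated at `ξ`, and the
jump between the two lines gives the factor `-Φ`. -/
lemma exists_analytic_on_wide_strip {lam β : ℝ} (hlam : 1 < lam) (hβ : (2 + lam) / 2 < β)
    (hβ' : β < (3 + lam) / 2) (hne : ∀ m : ℤ, β ≠ (2 * (m : ℝ) + 1) * ((lam - 1) / 4)) :
    ∃ (β₁ : ℝ) (G : ℂ → ℂ), β < β₁ ∧ β₁ < β + (lam - 1) / 2 ∧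
      (∀ ξ : ℂ, β - (lam - 1) / 2 < ξ.im → ξ.im < β₁ → AnalyticAt ℂ G ξ ∧ G ξ ≠ 0) ∧
      (∀ ξ : ℂ, β - (lam - 1) / 2 < ξ.im → ξ.im < β → G ξ = Vpart lam β ξ) ∧
      ∀ ξ : ℂ, β < ξ.im → ξ.im < β₁ →
        G (ξ - ((lam - 1) / 2 : ℝ) * I) = -Phi lam ξ * G ξ := by
  obtain ⟨β₁, A, hw, hb1, h⟩ := exists_admissible hlam hβ hβ' hne
  have hl : 0 < lam - 1 := by linarith
  have hlc : (lam : ℂ) - 1 ≠ 0 := by exact_mod_cast hl.ne'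
  set a := 4 * Real.pi / (lam - 1) with ha
  have ha0 : 0 < a := by positivity
  have had : 2 * Real.pi / a = (lam - 1) / 2 := by rw [ha]; field_simp; ring
  set L : ℂ → ℂ := fun η => log (-Phi lam η) with hL
  set c : ℂ := 2 / (((lam : ℂ) - 1) * I) with hc
  have hVp : ∀ ξ, Vpart lam β ξ = exp (c * lineInt a L β ξ) := by
    intro ξ
    simp only [Vpart, lineInt, kernel_eq_ker, hL, hc, ha]
  classical
  set G : ℂ → ℂ := fun ξ => if ξ.im < β then exp (c * lineInt a L β ξ)
    else exp (c * lineInt a L β₁ ξ) with hG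
  have hlt := h.lt
  have an : ∀ b, β ≤ b → b ≤ β₁ → ∀ ξ : ℂ, b - (lam - 1) / 2 < ξ.im → ξ.im < b →
      AnalyticAt ℂ (fun ξ => exp (c * lineInt a L b ξ)) ξ := by
    intro b hb hb' ξ e1 e2
    set U : Set ℂ := {z | b - (lam - 1) / 2 < z.im} ∩ {z | z.im < b} with hU
    have hUo : IsOpen U := (isOpen_lt continuous_const continuous_im).inter
      (isOpen_lt continuous_im continuous_const)
    have hd : DifferentiableOn ℂ (lineInt a L b) U := fun z hz =>
      (h.hasDerivAt_lineInt hb hb' (by rw [had]; exact hz.1)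
        hz.2).2.differentiableAt.differentiableWithinAt
    have := hd.analyticAt (hUo.mem_nhds (⟨e1, e2⟩ : ξ ∈ U))
    fun_prop
  refine ⟨β₁, G, h.lt, hw, ?_, ?_, ?_⟩
  · intro ξ e1 e2
    refine ⟨?_, by simp only [hG]; split_ifs <;> exact exp_ne_zero _⟩
    rcases lt_or_ge ξ.im β with e3 | e3
    · refine (an β le_rfl hlt.le ξ e1 e3).congr ?_
      filter_upwards [(isOpen_lt continuous_im continuous_const).mem_nhds e3] with z hz
      have hz : z.im < β := hz
      simp only [hG, if_pos hz]
    · refine (an β₁ hlt.le le_rfl ξ (by linarith) e2).congr ?_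
      have e4 : β₁ - (lam - 1) / 2 < ξ.im := by linarith
      filter_upwards [(isOpen_lt continuous_const continuous_im).mem_nhds e4] with z hz
      have hz : β₁ - (lam - 1) / 2 < z.im := hz
      simp only [hG]
      split_ifs with hz'
      · rw [h.lineInt_eq (by rw [had]; exact hz) hz']
      · rfl
  · intro ξ _ e2
    simp only [hG, if_pos e2, hVp]
  · intro ξ e1 e2
    have e3 : (ξ - ((lam - 1) / 2 : ℝ) * I).im < β := by
      have : (ξ - ((lam - 1) / 2 : ℝ) * I).im = ξ.im - (lam - 1) / 2 := by
        rw [sub_im, im_ofReal_mul, I_im, mul_one]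
      rw [this]; linarith
    simp only [hG, if_pos e3, if_neg (not_lt.2 e1.le)]
    have h1 := lineInt_sub_period ha0 L β ξ
    have h2 := h.lineInt_sub e1 e2
    rw [had] at h1 h2
    have hne : -Phi lam ξ ≠ 0 :=
      slitPlane_ne_zero (neg_Phi_mem_slitPlane (by linarith) (by linarith))
    have h3 : c * lineInt a L β ξ = L ξ + c * lineInt a L β₁ ξ := by
      have : c * (((lam - 1) / 2 : ℝ) * I * L ξ) = L ξ := by
        rw [hc]
        push_cast
        field_simp
      rw [← h2] at this
      linear_combination this
    rw [h1, h3, exp_add, hL, exp_log hne]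

/-! ### Meromorphic extension by the functional equation -/

/-- The factor relating the values of the extension on the `m`-th translate of a strip to those
on the strip itself. -/
noncomputable def layerFactor (φ : ℂ → ℂ) (d : ℝ) : ℤ → ℂ → ℂ
  | Int.ofNat n => fun ξ => ∏ j ∈ Finset.range n, (φ (ξ - j * d * I))⁻¹
  | Int.negSucc n => fun ξ => ∏ j ∈ Finset.range (n + 1), φ (ξ + (j + 1) * d * I)

lemma layerFactor_succ {φ : ℂ → ℂ} {d : ℝ} (m : ℤ) {ξ : ℂ} (h : φ (ξ - m * d * I) ≠ 0) :
    layerFactor φ d (m + 1) ξ = layerFactor φ d m ξ * (φ (ξ - m * d * I))⁻¹ := by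
  rcases m with n | n
  · show layerFactor φ d (Int.ofNat (n + 1)) ξ = _
    simp only [layerFactor]
    rw [Finset.prod_range_succ]
    simp
  · have e : ξ - ((Int.negSucc n : ℤ) : ℂ) * d * I = ξ + (n + 1) * d * I := by
      rw [Int.cast_negSucc]; push_cast; ring
    rw [e] at h ⊢
    rcases n with _ | n
    · show layerFactor φ d (Int.ofNat 0) ξ = _
      simp only [layerFactor, Finset.range_zero, Finset.prod_empty, zero_add,
        Finset.prod_range_one]
      rw [mul_inv_cancel₀ h]
    · show layerFactor φ d (Int.negSucc n) ξ = _
      simp only [layerFactor]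
      rw [Finset.prod_range_succ _ (n + 1), mul_assoc, mul_inv_cancel₀ h, mul_one]

lemma meromorphic_layerFactor {φ : ℂ → ℂ} (hφ : Meromorphic φ) (d : ℝ) (m : ℤ) :
    Meromorphic (layerFactor φ d m) := by
  have hs : ∀ s : ℂ, Meromorphic fun ξ => φ (ξ - s) := fun s ξ =>
    MeromorphicAt.comp_analyticAt (f := φ) (g := fun ξ : ℂ => ξ - s) (hφ _) (by fun_prop)
  rcases m with n | n
  · intro ξ
    exact MeromorphicAt.fun_prod fun j _ => (hs _ ξ).inv
  · intro ξ
    refine MeromorphicAt.fun_prod fun j _ => ?_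
    simpa using hs (-((j + 1) * d * I)) ξ

/-- A function on a strip with a multiplicative functional equation under the period extends
meromorphically to the plane. -/
lemma exists_meromorphic_extension {φ G : ℂ → ℂ} {d c₀ c₁ : ℝ} (hφ : Meromorphic φ)
    (hd : 0 < d) (h1 : c₀ + d < c₁) (h2 : c₁ < c₀ + 2 * d)
    (hG : ∀ ξ : ℂ, c₀ < ξ.im → ξ.im < c₁ → AnalyticAt ℂ G ξ ∧ G ξ ≠ 0)
    (hrel : ∀ ξ : ℂ, c₀ + d < ξ.im → ξ.im < c₁ → G (ξ - d * I) = φ ξ * G ξ) :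
    ∃ V : ℂ → ℂ, Meromorphic V ∧ ∀ ξ : ℂ, c₀ < ξ.im → ξ.im < c₁ → V ξ = G ξ := by
  set W : ℤ → ℂ → ℂ := fun m ξ => G (ξ - m * d * I) * layerFactor φ d m ξ with hW
  have him : ∀ (m : ℤ) (ξ : ℂ), (ξ - m * d * I).im = ξ.im - m * d := by
    intro m ξ
    have : ((m : ℂ) * d * I).im = m * d := by
      rw [mul_I_im]
      simp
    rw [sub_im, this]
  have hstep : ∀ (m : ℤ) (ξ : ℂ), c₀ + d < ξ.im - m * d → ξ.im - m * d < c₁ →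
      W (m + 1) ξ = W m ξ := by
    intro m ξ e1 e2
    have r := hrel (ξ - m * d * I) (by rwa [him]) (by rwa [him])
    have hn : φ (ξ - m * d * I) ≠ 0 := fun h0 => by
      rw [h0, zero_mul] at r
      refine (hG (ξ - m * d * I - d * I) ?_ ?_).2 r
      · rw [sub_im, him]; simp; linarith
      · rw [sub_im, him]; simp; linarith
    simp only [hW]
    rw [layerFactor_succ m hn, show ξ - ((m + 1 : ℤ) : ℂ) * d * I = ξ - m * d * I - d * I by
      push_cast; ring, r]
    field_simp
  -- With this offset the window `[c, c + d)` lies strictly inside `(c₀, c₁)`, so a single formula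
  -- `W n` is valid near every point, window edges included.
  set c := (c₀ + (c₁ - d)) / 2 with hc
  set V : ℂ → ℂ := fun ξ => W ⌊(ξ.im - c) / d⌋ ξ with hV
  have hVW : ∀ (m : ℤ) (ξ : ℂ), c₀ < ξ.im - m * d → ξ.im - m * d < c₁ → V ξ = W m ξ := by
    intro m ξ e1 e2
    simp only [hV]
    have f1 := Int.floor_le ((ξ.im - c) / d)
    have f2 := Int.lt_floor_add_one ((ξ.im - c) / d)
    rw [le_div_iff₀ hd] at f1
    rw [div_lt_iff₀ hd] at f2
    set n := ⌊(ξ.im - c) / d⌋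
    -- Since `c₁ < c₀ + 2d`, only neighbouring layers can overlap, and one use of `hstep` suffices.
    have g1 : ((n - m : ℤ) : ℝ) < 2 := by
      push_cast
      by_contra hcon
      nlinarith
    have g2 : (-2 : ℝ) < ((n - m : ℤ) : ℝ) := by
      push_cast
      by_contra hcon
      nlinarith
    have g3 : n - m < 2 := by exact_mod_cast g1
    have g4 : -2 < n - m := by exact_mod_cast g2
    obtain h | h | h : n = m ∨ n = m + 1 ∨ m = n + 1 := by omega
    · rw [h]
    · rw [h] at f1 ⊢
      push_cast at f1
      exact hstep m ξ (by linarith) e2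
    · rw [h] at e1 ⊢
      push_cast at e1
      exact (hstep n ξ (by linarith) (by linarith)).symm
  refine ⟨V, fun ξ => ?_, fun ξ e1 e2 => ?_⟩
  · have f1 := Int.floor_le ((ξ.im - c) / d)
    have f2 := Int.lt_floor_add_one ((ξ.im - c) / d)
    rw [le_div_iff₀ hd] at f1
    rw [div_lt_iff₀ hd] at f2
    set n := ⌊(ξ.im - c) / d⌋
    have e1 : c₀ < ξ.im - n * d := by linarith
    have e2 : ξ.im - n * d < c₁ := by linarith
    have hWm : MeromorphicAt (W n) ξ := by
      refine MeromorphicAt.mul ?_ (meromorphic_layerFactor hφ d n ξ)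
      have ha := (hG (ξ - n * d * I) (by rwa [him]) (by rwa [him])).1
      exact MeromorphicAt.comp_analyticAt (f := G) (g := fun z : ℂ => z - n * d * I)
        ha.meromorphicAt (by fun_prop)
    refine hWm.congr (Filter.EventuallyEq.filter_mono ?_ nhdsWithin_le_nhds)
    have o1 : ∀ᶠ z : ℂ in 𝓝 ξ, c₀ < z.im - n * d :=
      (isOpen_lt continuous_const (by fun_prop)).mem_nhds e1
    have o2 : ∀ᶠ z : ℂ in 𝓝 ξ, z.im - n * d < c₁ :=
      (isOpen_lt (by fun_prop) continuous_const).mem_nhds e2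
    filter_upwards [o1, o2] with z z1 z2
    exact (hVW n z z1 z2).symm
  · rw [hVW 0 ξ (by simpa) (by simpa)]
    simp only [hW, Int.cast_zero, zero_mul, sub_zero]
    show G ξ * layerFactor φ d (Int.ofNat 0) ξ = _
    simp [layerFactor]

/-! ### Orders of Gamma and of `-Φ` -/

lemma meromorphic_Gamma_comp (c : ℂ) : Meromorphic fun ξ : ℂ => Gamma (I * ξ + c) := fun ξ =>
  MeromorphicAt.comp_analyticAt (f := Gamma) (g := fun ξ : ℂ => I * ξ + c)
    (Meromorphic.Gamma _) (by fun_prop)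

lemma meromorphic_neg_Phi (lam : ℝ) : Meromorphic fun ξ => -Phi lam ξ := by
  intro ξ
  simp only [neg_Phi_eq, add_assoc]
  exact (MeromorphicAt.const _ ξ).mul
    ((meromorphic_Gamma_comp _ ξ).div (meromorphic_Gamma_comp _ ξ))

open Classical in
lemma meromorphicOrderAt_Gamma (s : ℂ) :
    meromorphicOrderAt Gamma s = ((if ∃ m : ℕ, s = -m then -1 else 0 : ℤ) : WithTop ℤ) := by
  have reg : ∀ s : ℂ, (∀ m : ℕ, s ≠ -m) → meromorphicOrderAt Gamma s = 0 := by
    intro s hs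
    have hc : ContinuousAt Gamma s := (differentiableAt_Gamma s hs).continuousAt
    exact (tendsto_ne_zero_iff_meromorphicOrderAt_eq_zero (Meromorphic.Gamma s)).1
      ⟨Gamma s, Gamma_ne_zero hs, hc.tendsto.mono_left nhdsWithin_le_nhds⟩
  split_ifs with h
  · obtain ⟨m, rfl⟩ := h
    -- From `Γ(z+1) = zΓ(z)`: the order drops by one in passing from `1` to `0` and is unchanged
    -- further to the left.
    have hrec : ∀ s : ℂ, meromorphicOrderAt Gamma (s + 1) =
        meromorphicOrderAt id s + meromorphicOrderAt Gamma s := by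
      intro s
      rw [← meromorphicOrderAt_comp_add_const_eq_meromorphicOrderAt,
        ← meromorphicOrderAt_mul (MeromorphicAt.id s) (Meromorphic.Gamma s)]
      refine meromorphicOrderAt_congr ?_
      have h0 : ∀ᶠ z in 𝓝[≠] s, z ≠ 0 := by
        rcases eq_or_ne s 0 with rfl | hs
        · exact self_mem_nhdsWithin
        · exact eventually_nhdsWithin_of_eventually_nhds (eventually_ne_nhds hs)
      filter_upwards [h0] with z hz
      simp [Gamma_add_one z hz]
    induction m with
    | zero =>
      have := hrec 0
      rw [meromorphicOrderAt_id, zero_add, reg 1 (by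
        intro m hm
        have := congrArg re hm
        simp at this
        have h2 : (0 : ℝ) ≤ m := by positivity
        linarith)] at this
      simp only [Nat.cast_zero, neg_zero]
      induction hx : meromorphicOrderAt Gamma 0 using WithTop.recTopCoe with
      | top => simp [hx] at this
      | coe x =>
        rw [hx] at this
        norm_cast at this ⊢
        omega
    | succ m ih =>
      have := hrec (-((m + 1 : ℕ) : ℂ))
      have e : -((m + 1 : ℕ) : ℂ) + 1 = -(m : ℂ) := by push_cast; ring
      have hz : -((m + 1 : ℕ) : ℂ) ≠ 0 := neg_ne_zero.2 (by exact_mod_cast Nat.succ_ne_zero m)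
      have hid : meromorphicOrderAt id (-((m + 1 : ℕ) : ℂ)) = 0 :=
        (tendsto_ne_zero_iff_meromorphicOrderAt_eq_zero (MeromorphicAt.id _)).1
          ⟨_, hz, continuousAt_id.tendsto.mono_left nhdsWithin_le_nhds⟩
      rw [e, ih, hid, zero_add] at this
      exact this.symm
  · push Not at h
    exact reg s h

lemma meromorphicOrderAt_Gamma_comp (c ξ : ℂ) :
    meromorphicOrderAt (fun ξ : ℂ => Gamma (I * ξ + c)) ξ = meromorphicOrderAt Gamma (I * ξ + c) := by
  refine meromorphicOrderAt_comp_of_deriv_ne_zero (f := Gamma) (g := fun ξ : ℂ => I * ξ + c)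
    (by fun_prop) ?_
  have : HasDerivAt (fun ξ : ℂ => I * ξ + c) I ξ := by
    simpa using ((hasDerivAt_id ξ).const_mul I).add_const c
  rw [this.deriv]
  exact I_ne_zero

lemma I_mul_add_eq_neg_iff (A : ℝ) (ξ : ℂ) (m : ℕ) :
    I * ξ + A = -m ↔ ξ = ((A + m : ℝ) : ℂ) * I := by
  constructor
  · intro h
    have : ξ = -I * (I * ξ) := by rw [← mul_assoc]; simp
    rw [this, eq_sub_of_add_eq h]
    push_cast
    ring
  · rintro rfl
    push_cast
    linear_combination (A + m : ℂ) * I_mul_I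

open Classical in
lemma meromorphicOrderAt_neg_Phi (lam : ℝ) (ξ : ℂ) :
    meromorphicOrderAt (fun ξ => -Phi lam ξ) ξ =
      (((if ∃ m : ℕ, ξ = (((1 + lam) / 2 + m : ℝ) : ℂ) * I then 1 else 0) -
        (if ∃ m : ℕ, ξ = ((1 + lam / 2 + m : ℝ) : ℂ) * I then 1 else 0) : ℤ) : WithTop ℤ) := by
  have e1 : (fun ξ => -Phi lam ξ) = fun ξ => ((2 * √Real.pi : ℝ) : ℂ) *
      (Gamma (I * ξ + ((1 + lam / 2 : ℝ) : ℂ)) / Gamma (I * ξ + (((1 + lam) / 2 : ℝ) : ℂ))) := by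
    funext ξ
    rw [neg_Phi_eq, show I * ξ + ((lam : ℂ) + 1) / 2 + 1 / 2 = I * ξ + ((1 + lam / 2 : ℝ) : ℂ) by
      push_cast; ring, show I * ξ + ((lam : ℂ) + 1) / 2 = I * ξ + (((1 + lam) / 2 : ℝ) : ℂ) by
      push_cast; ring]
  have h1 := meromorphic_Gamma_comp ((1 + lam / 2 : ℝ) : ℂ) ξ
  have h2 := meromorphic_Gamma_comp (((1 + lam) / 2 : ℝ) : ℂ) ξ
  have hc : ((2 * √Real.pi : ℝ) : ℂ) ≠ 0 := by
    have : 0 < 2 * √Real.pi := by positivity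
    exact_mod_cast this.ne'
  rw [e1, fun_meromorphicOrderAt_mul (MeromorphicAt.const _ _) (h1.fun_div h2),
    fun_meromorphicOrderAt_div h1 h2, meromorphicOrderAt_const, if_neg hc, zero_add,
    meromorphicOrderAt_Gamma_comp, meromorphicOrderAt_Gamma_comp, meromorphicOrderAt_Gamma,
    meromorphicOrderAt_Gamma]
  simp only [I_mul_add_eq_neg_iff]
  norm_cast
  split_ifs <;> rfl

/-! ### Counting occurrences in the lists -/

/-- Multiplicity of `ξ` in the list `(A + n + k d) i`, `n ≥ 1`, `k ≥ 0`. -/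
noncomputable def upCount (d A : ℝ) (ξ : ℂ) : ℕ :=
  {p : ℕ × ℕ | 1 ≤ p.1 ∧ ξ = ((A + p.1 + p.2 * d : ℝ) : ℂ) * I}.ncard

/-- Multiplicity of `ξ` in the list `(B - k d) i`, `k ≥ 1`. -/
noncomputable def lowCount (d B : ℝ) (ξ : ℂ) : ℕ :=
  {k : ℕ | 1 ≤ k ∧ ξ = ((B - k * d : ℝ) : ℂ) * I}.ncard

lemma finite_upCount {d : ℝ} (hd : 0 < d) (A : ℝ) (ξ : ℂ) :
    {p : ℕ × ℕ | 1 ≤ p.1 ∧ ξ = ((A + p.1 + p.2 * d : ℝ) : ℂ) * I}.Finite := by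
  refine ((Set.finite_Iic ⌈ξ.im - A⌉₊).prod (Set.finite_Iic ⌈(ξ.im - A) / d⌉₊)).subset ?_
  rintro ⟨n, k⟩ ⟨-, h⟩
  have h := congrArg im h
  rw [im_ofReal_mul, I_im, mul_one] at h
  have hk : 0 ≤ (k : ℝ) * d := by positivity
  have hn : (0 : ℝ) ≤ n := by positivity
  constructor
  · have : (n : ℝ) ≤ ⌈ξ.im - A⌉₊ := le_trans (by simp only at h; linarith) (Nat.le_ceil _)
    exact_mod_cast this
  · have : (k : ℝ) ≤ ⌈(ξ.im - A) / d⌉₊ := by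
      refine le_trans ?_ (Nat.le_ceil _)
      rw [le_div_iff₀ hd]
      simp only at h
      linarith
    exact_mod_cast this

lemma finite_lowCount {d : ℝ} (hd : 0 < d) (B : ℝ) (ξ : ℂ) :
    {k : ℕ | 1 ≤ k ∧ ξ = ((B - k * d : ℝ) : ℂ) * I}.Finite := by
  refine Set.Subsingleton.finite ?_
  rintro k ⟨-, h⟩ l ⟨-, h'⟩
  have h := congrArg im (h.symm.trans h')
  simp only [im_ofReal_mul, I_im, mul_one] at h
  have : (k : ℝ) = l := by
    have : (k : ℝ) * d = l * d := by linarith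
    exact mul_right_cancel₀ hd.ne' this
  exact_mod_cast this

lemma sub_mul_I_eq_iff (ξ : ℂ) (d r s : ℝ) (h : s = r + d) :
    ξ - d * I = (r : ℂ) * I ↔ ξ = (s : ℂ) * I := by
  subst h
  rw [sub_eq_iff_eq_add]
  push_cast
  rw [add_mul]

open Classical in
-- Entries with `k ≥ 1` at `ξ` are the entries with `k - 1` at `ξ - di`; those with `k = 0` form the
-- extra term.
lemma upCount_eq {d : ℝ} (hd : 0 < d) (A : ℝ) (ξ : ℂ) :
    upCount d A ξ = upCount d A (ξ - d * I) +
      if ∃ n : ℕ, 1 ≤ n ∧ ξ = ((A + n : ℝ) : ℂ) * I then 1 else 0 := by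
  set T : Set (ℕ × ℕ) := {p | p.2 = 0 ∧ 1 ≤ p.1 ∧ ξ = ((A + p.1 : ℝ) : ℂ) * I} with hT
  set f : ℕ × ℕ → ℕ × ℕ := fun p => (p.1, p.2 + 1) with hf
  have hfi : Function.Injective f := by
    rintro ⟨a, b⟩ ⟨c, e⟩ h
    simp only [hf, Prod.mk.injEq, add_left_inj] at h
    exact Prod.ext h.1 h.2
  have hTs : T.Subsingleton := by
    rintro ⟨n, k⟩ ⟨h1, -, h⟩ ⟨n', k'⟩ ⟨h1', -, h'⟩
    have h := congrArg im (h.symm.trans h')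
    simp only [im_ofReal_mul, I_im, mul_one, add_right_inj, Nat.cast_inj] at h
    exact Prod.ext h (h1.trans h1'.symm)
  have key : ∀ (n k : ℕ), ξ - d * I = ((A + n + k * d : ℝ) : ℂ) * I ↔
      ξ = ((A + n + (k + 1 : ℕ) * d : ℝ) : ℂ) * I := fun n k =>
    sub_mul_I_eq_iff _ _ _ _ (by push_cast; ring)
  have hdec : {p : ℕ × ℕ | 1 ≤ p.1 ∧ ξ = ((A + p.1 + p.2 * d : ℝ) : ℂ) * I} =
      f '' {p : ℕ × ℕ | 1 ≤ p.1 ∧ ξ - d * I = ((A + p.1 + p.2 * d : ℝ) : ℂ) * I} ∪ T := by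
    ext ⟨n, k⟩
    constructor
    · rintro ⟨h1, h2⟩
      rcases k with _ | k
      · right
        exact ⟨rfl, h1, by simpa using h2⟩
      · left
        exact ⟨(n, k), ⟨h1, (key n k).2 h2⟩, rfl⟩
    · rintro (⟨⟨n', k'⟩, ⟨h1, h2⟩, h3⟩ | ⟨h1, h2, h3⟩)
      · simp only [hf, Prod.mk.injEq] at h3
        obtain ⟨rfl, rfl⟩ := h3
        exact ⟨h1, (key _ _).1 h2⟩
      · simp only at h1 h2 h3
        subst h1
        exact ⟨h2, by simpa using h3⟩
  have hdisj : Disjoint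
      (f '' {p : ℕ × ℕ | 1 ≤ p.1 ∧ ξ - d * I = ((A + p.1 + p.2 * d : ℝ) : ℂ) * I}) T := by
    rw [Set.disjoint_left]
    rintro _ ⟨p, -, rfl⟩ ⟨h, -⟩
    simp [hf] at h
  rw [upCount, upCount, hdec, Set.ncard_union_eq hdisj ((finite_upCount hd A _).image f)
    hTs.finite, Set.ncard_image_of_injective _ hfi]
  congr 1
  split_ifs with h
  · obtain ⟨n, h1, h2⟩ := h
    rw [Set.ncard_eq_one]
    exact ⟨(n, 0), hTs.eq_singleton_of_mem ⟨rfl, h1, h2⟩⟩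
  · rw [Set.ncard_eq_zero hTs.finite, Set.eq_empty_iff_forall_notMem]
    rintro ⟨n, k⟩ ⟨-, h1, h2⟩
    exact h ⟨n, h1, h2⟩

open Classical in
lemma lowCount_sub_eq {d : ℝ} (hd : 0 < d) (B : ℝ) (ξ : ℂ) :
    lowCount d B (ξ - d * I) = lowCount d B ξ + if ξ = (B : ℂ) * I then 1 else 0 := by
  set T : Set ℕ := {k | k = 1 ∧ ξ = (B : ℂ) * I} with hT
  have hTs : T.Subsingleton := fun k hk l hl => hk.1.trans hl.1.symm
  have key : ∀ k : ℕ, ξ - d * I = ((B - (k + 1 : ℕ) * d : ℝ) : ℂ) * I ↔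
      ξ = ((B - k * d : ℝ) : ℂ) * I := fun k =>
    sub_mul_I_eq_iff _ _ _ _ (by push_cast; ring)
  have hdec : {k : ℕ | 1 ≤ k ∧ ξ - d * I = ((B - k * d : ℝ) : ℂ) * I} =
      (fun k => k + 1) '' {k : ℕ | 1 ≤ k ∧ ξ = ((B - k * d : ℝ) : ℂ) * I} ∪ T := by
    ext k
    constructor
    · rintro ⟨h1, h2⟩
      obtain ⟨k, rfl⟩ : ∃ l, k = l + 1 := ⟨k - 1, by omega⟩
      have h2 := (key k).1 h2
      rcases k with _ | k
      · right
        exact ⟨rfl, by simpa using h2⟩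
      · left
        exact ⟨k + 1, ⟨by omega, h2⟩, rfl⟩
    · rintro (⟨l, ⟨h1, h2⟩, rfl⟩ | ⟨rfl, h⟩)
      · exact ⟨Nat.le_add_left 1 l, (key l).2 h2⟩
      · exact ⟨le_rfl, (key 0).2 (by simpa using h)⟩
  have hdisj : Disjoint
      ((fun k => k + 1) '' {k : ℕ | 1 ≤ k ∧ ξ = ((B - k * d : ℝ) : ℂ) * I}) T := by
    rw [Set.disjoint_left]
    rintro _ ⟨p, ⟨hp, -⟩, rfl⟩ ⟨h, -⟩
    have h : p + 1 = 1 := h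
    omega
  rw [lowCount, lowCount, hdec, Set.ncard_union_eq hdisj ((finite_lowCount hd B _).image _)
    hTs.finite, Set.ncard_image_of_injective _ (add_left_injective 1)]
  congr 1
  split_ifs with h
  · rw [Set.ncard_eq_one]
    exact ⟨1, hTs.eq_singleton_of_mem ⟨rfl, h⟩⟩
  · rw [Set.ncard_eq_zero hTs.finite, Set.eq_empty_iff_forall_notMem]
    rintro k ⟨-, h1⟩
    exact h h1

lemma zeroCount_eq (lam : ℝ) (ξ : ℂ) : zeroCount lam ξ =
    upCount ((lam - 1) / 2) (1 + lam / 2) ξ + lowCount ((lam - 1) / 2) ((1 + lam) / 2) ξ := rfl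

lemma poleCount_eq (lam : ℝ) (ξ : ℂ) : poleCount lam ξ =
    upCount ((lam - 1) / 2) ((1 + lam) / 2) ξ + lowCount ((lam - 1) / 2) (1 + lam / 2) ξ := rfl

/-- The order predicted by the lists of zeros and poles. -/
noncomputable def listOrder (lam : ℝ) (ξ : ℂ) : ℤ := (zeroCount lam ξ : ℤ) - poleCount lam ξ

lemma exists_nat_iff_zero_or {P : ℕ → Prop} : (∃ n, P n) ↔ P 0 ∨ ∃ n, 1 ≤ n ∧ P n := by
  constructor
  · rintro ⟨n, hn⟩
    rcases n with _ | n
    · exact Or.inl hn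
    · exact Or.inr ⟨n + 1, by omega, hn⟩
  · rintro (h | ⟨n, -, hn⟩)
    exacts [⟨0, h⟩, ⟨n, hn⟩]

open Classical in
lemma ite_exists_add (A : ℝ) (ξ : ℂ) :
    (if ∃ n : ℕ, ξ = ((A + n : ℝ) : ℂ) * I then 1 else 0 : ℤ) =
      (if ∃ n : ℕ, 1 ≤ n ∧ ξ = ((A + n : ℝ) : ℂ) * I then 1 else 0) +
        if ξ = (A : ℂ) * I then 1 else 0 := by
  rw [exists_nat_iff_zero_or]
  simp only [Nat.cast_zero, add_zero]
  by_cases h1 : ξ = (A : ℂ) * I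
  · have h2 : ¬ ∃ n : ℕ, 1 ≤ n ∧ ξ = ((A + n : ℝ) : ℂ) * I := by
      rintro ⟨n, hn, h⟩
      have h := congrArg im (h1.symm.trans h)
      simp only [im_ofReal_mul, I_im, mul_one, left_eq_add, Nat.cast_eq_zero] at h
      omega
    rw [if_neg h2]
    simp [h1]
  · simp [h1]

/-- In the difference, the upper lists contribute their `k = 0` entries, that is the zeros and poles
of `-Φ` with `n ≥ 1`. The lower lists contribute the missing `n = 0` points. -/
lemma meromorphicOrderAt_neg_Phi_eq {lam : ℝ} (hlam : 1 < lam) (ξ : ℂ) :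
    meromorphicOrderAt (fun ξ => -Phi lam ξ) ξ =
      ((listOrder lam (ξ - ((lam - 1) / 2 : ℝ) * I) - listOrder lam ξ : ℤ) : WithTop ℤ) := by
  classical
  have hd : 0 < (lam - 1) / 2 := by linarith
  rw [meromorphicOrderAt_neg_Phi, listOrder, listOrder, zeroCount_eq, zeroCount_eq, poleCount_eq,
    poleCount_eq, upCount_eq hd _ ξ, upCount_eq hd _ ξ, lowCount_sub_eq hd, lowCount_sub_eq hd,
    ite_exists_add, ite_exists_add]
  congr 1
  push_cast
  ring

/-- The upper lists start no lower than `(3+λ)/2 > β`. The lower lists start no higher than one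
period below `(2+λ)/2 < β`. -/
lemma listOrder_eq_zero {lam β : ℝ} (hlam : 1 < lam) (hβ : (2 + lam) / 2 < β)
    (hβ' : β < (3 + lam) / 2) {ξ : ℂ} (h1 : β - (lam - 1) / 2 < ξ.im)
    (h2 : ξ.im ≤ β) : listOrder lam ξ = 0 := by
  have hd : 0 < (lam - 1) / 2 := by linarith
  have up : ∀ A : ℝ, β < A + 1 → upCount ((lam - 1) / 2) A ξ = 0 := by
    intro A hA
    rw [upCount, Set.ncard_eq_zero (finite_upCount hd A ξ), Set.eq_empty_iff_forall_notMem]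
    rintro ⟨n, k⟩ ⟨hn, h⟩
    have h := congrArg im h
    simp only [im_ofReal_mul, I_im, mul_one] at h
    have h3 : 0 ≤ (k : ℝ) * ((lam - 1) / 2) := by positivity
    have h4 : (1 : ℝ) ≤ n := by exact_mod_cast hn
    linarith
  have low : ∀ B : ℝ, B < β → lowCount ((lam - 1) / 2) B ξ = 0 := by
    intro B hB
    rw [lowCount, Set.ncard_eq_zero (finite_lowCount hd B ξ), Set.eq_empty_iff_forall_notMem]
    rintro k ⟨hn, h⟩
    have h := congrArg im h
    simp only [im_ofReal_mul, I_im, mul_one] at h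
    have h4 : (1 : ℝ) ≤ k := by exact_mod_cast hn
    nlinarith
  rw [listOrder, zeroCount_eq, poleCount_eq, up _ (by linarith), up _ (by linarith),
    low _ (by linarith), low _ (by linarith)]
  simp

/-! ### Orders of the extension -/

/-- Identity theorem for meromorphic functions on a preconnected set. -/
lemma eventuallyEq_of_preconnected {f g : ℂ → ℂ} {U : Set ℂ} (hf : MeromorphicOn f U)
    (hg : MeromorphicOn g U) (hU : IsPreconnected U) {x y : ℂ} (hx : x ∈ U) (hy : y ∈ U)
    (h : f =ᶠ[𝓝[≠] x] g) : f =ᶠ[𝓝[≠] y] g := by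
  have htop : meromorphicOrderAt (f - g) x = ⊤ := by
    rw [meromorphicOrderAt_eq_top_iff]
    filter_upwards [h] with z hz
    simp [hz]
  have : meromorphicOrderAt (f - g) y = ⊤ := by
    by_contra hne
    exact (hf.sub hg).meromorphicOrderAt_ne_top_of_isPreconnected hU hy hx hne htop
  rw [meromorphicOrderAt_eq_top_iff] at this
  filter_upwards [this] with z hz
  exact sub_eq_zero.1 hz

lemma isOpen_strip (c₀ c₁ : ℝ) : IsOpen {z : ℂ | c₀ < z.im ∧ z.im < c₁} :=
  (isOpen_lt continuous_const continuous_im).inter (isOpen_lt continuous_im continuous_const)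

lemma isPreconnected_strip (c₀ c₁ : ℝ) : IsPreconnected {z : ℂ | c₀ < z.im ∧ z.im < c₁} :=
  ((convex_halfSpace_im_gt c₀).inter (convex_halfSpace_im_lt c₁)).isPreconnected

/-- The orders of a meromorphic function `V` with a multiplicative functional equation. -/
lemma meromorphicOrderAt_eq_of_functional_equation {V G φ : ℂ → ℂ} {N : ℂ → ℤ} {d c₀ c₁ : ℝ}
    (hφ : Meromorphic φ) (hd : 0 < d) (h1 : c₀ + d < c₁) (h2 : c₁ < c₀ + 2 * d)
    (hG : ∀ ξ : ℂ, c₀ < ξ.im → ξ.im < c₁ → AnalyticAt ℂ G ξ ∧ G ξ ≠ 0)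
    (hrel : ∀ ξ : ℂ, c₀ + d < ξ.im → ξ.im < c₁ → G (ξ - d * I) = φ ξ * G ξ)
    (hV : Meromorphic V) (hVG : ∀ ξ : ℂ, c₀ < ξ.im → ξ.im < c₀ + d → V ξ = G ξ)
    (hN : ∀ ξ : ℂ, c₀ < ξ.im → ξ.im ≤ c₀ + d → N ξ = 0)
    (hφN : ∀ ξ : ℂ, meromorphicOrderAt φ ξ = ((N (ξ - d * I) - N ξ : ℤ) : WithTop ℤ)) (ξ : ℂ) :
    meromorphicOrderAt V ξ = (N ξ : WithTop ℤ) := by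
  have im_c : ∀ r : ℝ, ((r : ℂ) * I).im = r := by simp
  have im_d : ∀ ξ : ℂ, (ξ - d * I).im = ξ.im - d := by simp
  -- Agreement is known only below `c₀ + d`; the identity theorem carries it to the wider strip,
  -- which is needed to treat the line `Im ξ = c₀ + d`. Germs are punctured because the value of `V`
  -- at a single point is not controlled.
  have hVGev : ∀ ξ : ℂ, c₀ < ξ.im → ξ.im < c₁ → V =ᶠ[𝓝[≠] ξ] G := by
    intro ξ e1 e2
    have hm : ((c₀ + d / 2 : ℝ) * I : ℂ).im = c₀ + d / 2 := im_c _
    refine eventuallyEq_of_preconnected (U := {z | c₀ < z.im ∧ z.im < c₁})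
      (fun z _ => hV z) (fun z hz => (hG z hz.1 hz.2).1.meromorphicAt)
      (isPreconnected_strip _ _) (x := (c₀ + d / 2 : ℝ) * I)
      ⟨by rw [hm]; linarith, by rw [hm]; linarith⟩ ⟨e1, e2⟩ ?_
    refine Filter.EventuallyEq.filter_mono ?_ nhdsWithin_le_nhds
    filter_upwards [(isOpen_strip c₀ (c₀ + d)).mem_nhds
      ⟨by rw [hm]; linarith, by rw [hm]; linarith⟩] with z hz
    exact hVG z hz.1 hz.2
  have hshift : Meromorphic fun ξ => V (ξ - d * I) := fun ξ =>
    MeromorphicAt.comp_analyticAt (f := V) (g := fun ξ : ℂ => ξ - d * I) (hV _) (by fun_prop)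
  -- The functional equation holds near one point of the overlap, hence on the whole plane by the
  -- identity theorem.
  have hfe : ∀ ξ : ℂ, meromorphicOrderAt V (ξ - d * I) =
      meromorphicOrderAt φ ξ + meromorphicOrderAt V ξ := by
    intro ξ
    rw [← meromorphicOrderAt_mul (hφ ξ) (hV ξ),
      ← meromorphicOrderAt_fun_comp_sub_const_eq_meromorphicOrderAt]
    refine meromorphicOrderAt_congr ?_
    have hm : (((c₀ + d + c₁) / 2 : ℝ) * I : ℂ).im = (c₀ + d + c₁) / 2 := im_c _
    refine eventuallyEq_of_preconnected (U := Set.univ) (fun z _ => hshift z)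
      (fun z _ => (hφ.mul hV) z) isPreconnected_univ
      (x := ((c₀ + d + c₁) / 2 : ℝ) * I) trivial trivial ?_
    have hev := hVGev (((c₀ + d + c₁) / 2 : ℝ) * I) (by rw [hm]; linarith) (by rw [hm]; linarith)
    have hnb : ∀ᶠ z in 𝓝[≠] (((c₀ + d + c₁) / 2 : ℝ) * I : ℂ), c₀ + d < z.im ∧ z.im < c₁ :=
      nhdsWithin_le_nhds ((isOpen_strip (c₀ + d) c₁).mem_nhds
        ⟨by rw [hm]; linarith, by rw [hm]; linarith⟩)
    filter_upwards [hev, hnb] with z hz1 hz2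
    rw [Pi.mul_apply, hz1, ← hrel z hz2.1 hz2.2]
    exact hVG _ (by rw [im_d]; linarith [hz2.1]) (by rw [im_d]; linarith [hz2.2])
  have step : ∀ ξ : ℂ, meromorphicOrderAt V ξ = (N ξ : WithTop ℤ) ↔
      meromorphicOrderAt V (ξ - d * I) = (N (ξ - d * I) : WithTop ℤ) := by
    intro ξ
    rw [hfe ξ, hφN ξ]
    induction hx : meromorphicOrderAt V ξ using WithTop.recTopCoe with
    | top => simp
    | coe x =>
      norm_cast
      omega
  have base : ∀ ξ : ℂ, c₀ < ξ.im → ξ.im ≤ c₀ + d →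
      meromorphicOrderAt V ξ = (N ξ : WithTop ℤ) := by
    intro ξ e1 e2
    rw [hN ξ e1 e2, meromorphicOrderAt_congr (hVGev ξ e1 (by linarith))]
    obtain ⟨ha, hne⟩ := hG ξ e1 (by linarith)
    exact (tendsto_ne_zero_iff_meromorphicOrderAt_eq_zero ha.meromorphicAt).1
      ⟨_, hne, ha.continuousAt.tendsto.mono_left nhdsWithin_le_nhds⟩
  have up : ∀ (n : ℕ) (ξ : ℂ), meromorphicOrderAt V ξ = (N ξ : WithTop ℤ) ↔
      meromorphicOrderAt V (ξ - n * d * I) = (N (ξ - n * d * I) : WithTop ℤ) := by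
    intro n
    induction n with
    | zero => simp
    | succ n ih =>
      intro ξ
      rw [ih ξ, step, show ξ - ((n + 1 : ℕ) : ℂ) * d * I = ξ - n * d * I - d * I by
        push_cast; ring]
  have im_n : ∀ (n : ℤ) (ξ : ℂ), (ξ - n * d * I).im = ξ.im - n * d := by
    intro n ξ
    have : ((n : ℂ) * d * I).im = n * d := by
      rw [mul_I_im]
      simp
    rw [sub_im, this]
  -- Some translate by a multiple of `di` lands in the half-open base strip `(c₀, c₀ + d]`.
  obtain ⟨m, ⟨hm1, hm2⟩, -⟩ := existsUnique_sub_zsmul_mem_Ioc hd ξ.im c₀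
  rw [zsmul_eq_mul] at hm1 hm2
  have hb := base (ξ - m * d * I) (by rwa [im_n]) (by rwa [im_n])
  rcases le_total 0 m with hm | hm
  · lift m to ℕ using hm
    exact (up m ξ).2 (by simpa using hb)
  · obtain ⟨n, rfl⟩ : ∃ n : ℕ, m = -n := ⟨m.natAbs, by omega⟩
    have := (up n (ξ - ((-n : ℤ) : ℂ) * d * I)).1 hb
    rwa [show ξ - ((-n : ℤ) : ℂ) * d * I - n * d * I = ξ by push_cast; ring] at this

/-! ### Coincidences between the lists and conclusion -/

lemma mem_zeroSet_iff {lam : ℝ} (hlam : 1 < lam) (ξ : ℂ) :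
    ξ ∈ zeroSet lam ↔ 0 < zeroCount lam ξ := by
  have hd : 0 < (lam - 1) / 2 := by linarith
  rw [zeroCount_eq, Nat.add_pos_iff_pos_or_pos, upCount, lowCount,
    Set.ncard_pos (finite_upCount hd _ ξ), Set.ncard_pos (finite_lowCount hd _ ξ)]
  refine or_congr ?_ Iff.rfl
  exact ⟨fun ⟨n, k, h⟩ => ⟨(n, k), h⟩, fun ⟨p, h⟩ => ⟨p.1, p.2, h⟩⟩

lemma mem_poleSet_iff {lam : ℝ} (hlam : 1 < lam) (ξ : ℂ) :
    ξ ∈ poleSet lam ↔ 0 < poleCount lam ξ := by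
  have hd : 0 < (lam - 1) / 2 := by linarith
  rw [poleCount_eq, Nat.add_pos_iff_pos_or_pos, upCount, lowCount,
    Set.ncard_pos (finite_upCount hd _ ξ), Set.ncard_pos (finite_lowCount hd _ ξ)]
  refine or_congr ?_ Iff.rfl
  exact ⟨fun ⟨n, k, h⟩ => ⟨(n, k), h⟩, fun ⟨p, h⟩ => ⟨p.1, p.2, h⟩⟩

lemma exists_odd_mul_eq {x : ℝ} (hx : 0 < x) {r s : ℤ} (h : (r : ℝ) * x = 2 * s + 1) :
    ∃ p q : ℕ, Odd p ∧ (q : ℝ) * x = p := by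
  have key : ∀ r s : ℤ, 0 < r → (r : ℝ) * x = 2 * s + 1 → ∃ p q : ℕ, Odd p ∧ (q : ℝ) * x = p := by
    intro r s hr h
    have hr' : (0 : ℝ) < r := by exact_mod_cast hr
    have hs : (-1 : ℝ) < 2 * s := by nlinarith [mul_pos hr' hx]
    have hs' : -1 < 2 * s := by exact_mod_cast hs
    obtain ⟨q, rfl⟩ := Int.eq_ofNat_of_zero_le hr.le
    obtain ⟨p, rfl⟩ := Int.eq_ofNat_of_zero_le (show 0 ≤ s by omega)
    exact ⟨2 * p + 1, q, ⟨p, rfl⟩, by push_cast; exact_mod_cast h⟩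
  rcases lt_trichotomy r 0 with hr | rfl | hr
  · exact key (-r) (-s - 1) (by omega) (by push_cast; linarith)
  · exfalso
    have h : (0 : ℝ) = ((2 * s + 1 : ℤ) : ℝ) := by push_cast; simpa using h
    have h : (0 : ℤ) = 2 * s + 1 := by exact_mod_cast h
    omega
  · exact key r s hr h

/-- The lists of zeros and poles can only meet if `λ - 1` has an odd numerator. -/
lemma disjoint_zeroSet_poleSet {lam : ℝ} (hlam : 1 < lam)
    (h : ∀ p q : ℕ, Odd p → (q : ℝ) * (lam - 1) ≠ (p : ℝ)) : zeroSet lam ∩ poleSet lam = ∅ := by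
  have hd : 0 < lam - 1 := by linarith
  have no : ∀ r s : ℤ, (r : ℝ) * (lam - 1) ≠ 2 * s + 1 := by
    intro r s hrs
    obtain ⟨p, q, hp, hq⟩ := exists_odd_mul_eq hd hrs
    exact h p q hp hq
  have inj : ∀ r s : ℝ, (r : ℂ) * I = (s : ℂ) * I → r = s := by
    intro r s hrs
    simpa using congrArg im hrs
  rw [Set.eq_empty_iff_forall_notMem]
  rintro ξ ⟨⟨n, k, hn, rfl⟩ | ⟨k, hk, rfl⟩, ⟨n', k', hn', h'⟩ | ⟨k', hk', h'⟩⟩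
  -- The bases of the two upper lists differ by `1/2`, so equal entries give `(k'-k)(λ-1) = 2(n-n')
  -- + 1`. The two lower lists likewise give `(k'-k)(λ-1) = 1`, and an upper entry lies strictly
  -- above every lower one.
  · refine no (k' - k) (n - n') ?_
    have := inj _ _ h'
    push_cast
    linarith
  · have := inj _ _ h'
    have h1 : (0 : ℝ) ≤ k * ((lam - 1) / 2) := by positivity
    have h2 : (0 : ℝ) ≤ k' * ((lam - 1) / 2) := by positivity
    have h3 : (1 : ℝ) ≤ n := by exact_mod_cast hn
    linarith
  · have := inj _ _ h'
    have h1 : (0 : ℝ) ≤ k * ((lam - 1) / 2) := by positivity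
    have h2 : (0 : ℝ) ≤ k' * ((lam - 1) / 2) := by positivity
    have h3 : (1 : ℝ) ≤ n' := by exact_mod_cast hn'
    linarith
  · refine no (k' - k) 0 ?_
    have := inj _ _ h'
    push_cast
    linarith

end Coag

theorem mainTheorem6 (lam : ℝ) (hlam : 1 < lam) (hlam' : lam < 2)
    (β : ℝ) (hβ : (2 + lam) / 2 < β) (hβ' : β < (3 + lam) / 2)
    (hβ_ne : ∀ m : ℤ, β ≠ (2 * (m : ℝ) + 1) * ((lam - 1) / 4)) :
    (∃ V : ℂ → ℂ, Coag.IsMeromorphicExtension lam β V) ∧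
      ∀ V : ℂ → ℂ, Coag.IsMeromorphicExtension lam β V →
        (∀ ξ : ℂ, meromorphicOrderAt V ξ =
          (((Coag.zeroCount lam ξ : ℤ) - (Coag.poleCount lam ξ : ℤ) : ℤ) : WithTop ℤ)) ∧
        (∀ ξ : ℂ, ξ ∉ Coag.zeroSet lam ∩ Coag.poleSet lam →
          (ξ ∈ Coag.zerosOf V ↔ ξ ∈ Coag.zeroSet lam) ∧
          (ξ ∈ Coag.polesOf V ↔ ξ ∈ Coag.poleSet lam)) ∧
        ((∀ p q : ℕ, Odd p → (q : ℝ) * (lam - 1) ≠ (p : ℝ)) →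
          Coag.zerosOf V = Coag.zeroSet lam ∧ Coag.polesOf V = Coag.poleSet lam) := by
  have hd : 0 < (lam - 1) / 2 := by linarith
  obtain ⟨β₁, G, hb, hb', hG, hGV, hrel⟩ :=
    Coag.exists_analytic_on_wide_strip hlam hβ hβ' hβ_ne
  have hφ := Coag.meromorphic_neg_Phi lam
  have hc : β - (lam - 1) / 2 + (lam - 1) / 2 = β := by ring
  constructor
  · obtain ⟨V, hV, hVG⟩ := Coag.exists_meromorphic_extension hφ hd (by linarith) (by linarith) hG
      (by rwa [hc])
    exact ⟨V, hV, fun ξ e1 e2 => (hVG ξ e1 (by linarith)).trans (hGV ξ e1 e2)⟩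
  intro V ⟨hV, hVe⟩
  have hord : ∀ ξ : ℂ, meromorphicOrderAt V ξ =
      (((Coag.zeroCount lam ξ : ℤ) - (Coag.poleCount lam ξ : ℤ) : ℤ) : WithTop ℤ) :=
    Coag.meromorphicOrderAt_eq_of_functional_equation (N := Coag.listOrder lam) hφ hd
      (by linarith) (by linarith) hG (by rwa [hc]) hV
      (fun ξ e1 e2 => by rw [hc] at e2; rw [hVe ξ e1 e2, hGV ξ e1 e2])
      (fun ξ e1 e2 => Coag.listOrder_eq_zero hlam hβ hβ' e1 (by rwa [hc] at e2))
      (Coag.meromorphicOrderAt_neg_Phi_eq hlam)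
  have hoff : ∀ ξ : ℂ, ξ ∉ Coag.zeroSet lam ∩ Coag.poleSet lam →
      (ξ ∈ Coag.zerosOf V ↔ ξ ∈ Coag.zeroSet lam) ∧
      (ξ ∈ Coag.polesOf V ↔ ξ ∈ Coag.poleSet lam) := by
    intro ξ hξ
    rw [Set.mem_inter_iff, Coag.mem_zeroSet_iff hlam, Coag.mem_poleSet_iff hlam] at hξ
    rw [Coag.mem_zeroSet_iff hlam, Coag.mem_poleSet_iff hlam]
    have h1 : ξ ∈ Coag.zerosOf V ↔ 0 < meromorphicOrderAt V ξ := Iff.rfl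
    have h2 : ξ ∈ Coag.polesOf V ↔ meromorphicOrderAt V ξ < 0 := Iff.rfl
    rw [h1, h2, hord ξ]
    rw [show (0 : WithTop ℤ) = ((0 : ℤ) : WithTop ℤ) from rfl, WithTop.coe_lt_coe,
      WithTop.coe_lt_coe]
    omega
  refine ⟨hord, hoff, fun hodd => ?_⟩
  have hdisj := Coag.disjoint_zeroSet_poleSet hlam hodd
  have hnot : ∀ ξ : ℂ, ξ ∉ Coag.zeroSet lam ∩ Coag.poleSet lam := by simp [hdisj]
  exact ⟨Set.ext fun ξ => (hoff ξ (hnot ξ)).1, Set.ext fun ξ => (hoff ξ (hnot ξ)).2⟩
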